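/- Let $G\subset\mathbb R^d$ be a connected metric graph whose edges are straight segments or half-lines that meet only at vertices. Assume that $G$ is locally finite (every point of $\mathbb R^d$ has a neighbourhood that meets only finitely many edges), that $G$ is unbounded, and that $G$ is not a chain equivalent to $\mathbb R$ (that is, $G$ is not the image of an injective unit-speed curve defined on all of $\mathbb R$). Functions on $G$ are real- or complex-valued. Let $H^1(G)$ be the space of continuous functions $f$ on $G$ that lie in $H^1_{loc}$ of each closed edge and satisfy $$\|f\|_{H^1(G)}^2=\sum_{e}\int_e(|f'|^2+|f|^2)\,dx<\infty ,$$ and let $H^1_0(G)$ be the subspace of those $f$ that vanish at all outer vertices (the vertices that belong to exactly one edge). Let $2<p<\infty$ and $$F_{G,p}(f)=\frac{\int_G(|f'|^2+|f|^2)\,dx}{\left(\int_G|f|^p\,dx\right)^{2/p}},\qquad \frac1{C_p(G)}=\inf\{F_{G,p}(f): f\in H^1_0(G),\ f\neq0\}.$$ Let $(v_n)_n$ be a sequence in $H^1_0(G)$ with $\int_G|v_n|^p\,dx=1$ for all $n$ and $F_{G,p}(v_n)\to 1/C_p(G)$. Then either $(v_n)_n$ is relatively compact in $H^1_0(G)$,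 or it concentrates at infinity along a subsequence: there are a subsequence $(v_{n_k})_k$, functions $w_k\in H^1_0(G)$ and points $x_k\in G$ such that $|x_k|\to\infty$, such that for every $\varepsilon>0$ there is $R>0$ with, for all $k$, $$\int_{B_R(x_k)\cap G}|w_k|^p\,dx\ \ge\ 1-\varepsilon\qquad\text{and}\qquad \int_{G\setminus B_R(x_k)}(|w_k'|^2+|w_k|^2)\,dx\ \le\ \varepsilon ,$$ and such that $\|v_{n_k}-w_k\|_{H^1(G)}\to0$ as $k\to\infty$. -/

import Mathlib

open Set Filter Topology MeasureTheory
open scoped ENNReal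

noncomputable section

/-- A metric graph in `ℝ^d` with straight edges. The edge `e` starts at the vertex `src e`, has
unit direction `dir e` and length `len e ∈ (0, ∞]`: it is the segment from `src e` to
`src e + len e • dir e` if `len e` is finite, and a half-line otherwise. Edges meet each other only
at vertices. (The choice of the starting point of a bounded edge plays no role.) -/
structure EmbeddedGraph (d : ℕ) where
  Edge : Type
  src : Edge → EuclideanSpace ℝ (Fin d)
  dir : Edge → EuclideanSpace ℝ (Fin d)
  len : Edge → ℝ≥0∞
  norm_dir : ∀ e, ‖dir e‖ = 1
  len_pos : ∀ e, 0 < len e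
  /-- The relative interiors of two different edges are disjoint. -/
  interior_disjoint : ∀ e e' : Edge, e ≠ e' → ∀ s t : ℝ,
    0 < s → ENNReal.ofReal s < len e → 0 < t → ENNReal.ofReal t < len e' →
      src e + s • dir e ≠ src e' + t • dir e'
  /-- No starting point of an edge lies in the relative interior of an edge. -/
  src_not_interior : ∀ e e' : Edge, ∀ t : ℝ, 0 < t → ENNReal.ofReal t < len e' →
    src e ≠ src e' + t • dir e'
  /-- No (finite) end point of an edge lies in the relative interior of an edge. -/
  tgt_not_interior : ∀ e e' : Edge, len e ≠ ⊤ → ∀ t : ℝ, 0 < t → ENNReal.ofReal t < len e' →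
    src e + (len e).toReal • dir e ≠ src e' + t • dir e'

namespace EmbeddedGraph

variable {d : ℕ} (G : EmbeddedGraph d)

/-- Arc-length parametrisation of the edge `e`. -/
def point (e : G.Edge) (t : ℝ) : EuclideanSpace ℝ (Fin d) := G.src e + t • G.dir e

/-- Parameters of the closed edge: `[0, len e]`, or `[0, ∞)` for an unbounded edge. -/
def closedParam (e : G.Edge) : Set ℝ := {t | 0 ≤ t ∧ ENNReal.ofReal t ≤ G.len e}

/-- Parameters of the open edge: `(0, len e)`. -/
def openParam (e : G.Edge) : Set ℝ := {t | 0 < t ∧ ENNReal.ofReal t < G.len e}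

/-- The closed edge `e` as a subset of `ℝ^d`. -/
def closedEdge (e : G.Edge) : Set (EuclideanSpace ℝ (Fin d)) := G.point e '' G.closedParam e

/-- The graph as a subset of `ℝ^d`. -/
def carrier : Set (EuclideanSpace ℝ (Fin d)) := ⋃ e, G.closedEdge e

/-- The vertices are the endpoints of the edges. -/
def vertices : Set (EuclideanSpace ℝ (Fin d)) :=
  {V | ∃ e, V = G.src e ∨ (G.len e ≠ ⊤ ∧ V = G.src e + (G.len e).toReal • G.dir e)}

/-- The outer vertices are those that belong to exactly one edge. -/
def outerVertices : Set (EuclideanSpace ℝ (Fin d)) :=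
  {V | V ∈ G.vertices ∧ ∃! e, V ∈ G.closedEdge e}

/-- The edges do not accumulate: every point of `ℝ^d` has a neighbourhood that meets only finitely
many edges. -/
def IsLocallyFinite : Prop := LocallyFinite G.closedEdge

/-- The graph is unbounded as a subset of `ℝ^d`. -/
def IsUnbounded : Prop := ¬ Bornology.IsBounded G.carrier

/-- The graph is a chain of edges equivalent to `ℝ`: it is run through exactly once, at unit speed,
by an injective curve defined on all of `ℝ` (the angles between the edges are irrelevant). -/
def IsChainEquivReal : Prop :=
  ∃ γ : ℝ → EuclideanSpace ℝ (Fin d), Continuous γ ∧ Function.Injective γ ∧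
    HasUnitSpeedOn γ univ ∧ range γ = G.carrier

variable {𝕜 : Type*} [RCLike 𝕜]

/-! A function on the graph is represented by a function on `ℝ^d`, of which only the values on the
graph matter. -/

/-- `∫_{A ∩ G} (|f'|² + |f|²) dx`, where `f'` is the derivative along the edges. -/
def energyOn (f : EuclideanSpace ℝ (Fin d) → 𝕜) (A : Set (EuclideanSpace ℝ (Fin d))) : ℝ≥0∞ :=
  ∑' e, ∫⁻ t in G.openParam e ∩ G.point e ⁻¹' A,
    (‖deriv (fun s => f (G.point e s)) t‖ₑ ^ 2 + ‖f (G.point e t)‖ₑ ^ 2)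

/-- `∫_{A ∩ G} |f|^p dx`. -/
def massOn (p : ℝ) (f : EuclideanSpace ℝ (Fin d) → 𝕜) (A : Set (EuclideanSpace ℝ (Fin d))) :
    ℝ≥0∞ :=
  ∑' e, ∫⁻ t in G.openParam e ∩ G.point e ⁻¹' A, ‖f (G.point e t)‖ₑ ^ p

/-- The squared norm `‖f‖²_{H¹(G)} = ∫_G (|f'|² + |f|²) dx`. -/
def h1NormSq (f : EuclideanSpace ℝ (Fin d) → 𝕜) : ℝ≥0∞ := G.energyOn f univ

/-- `f ∈ H¹(G)`: `f` is continuous on the graph, its restriction to every edge is locally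
absolutely continuous, and `∫_G (|f'|² + |f|²) dx` is finite. -/
structure MemH1 (f : EuclideanSpace ℝ (Fin d) → 𝕜) : Prop where
  continuousOn : ContinuousOn f G.carrier
  absolutelyContinuous : ∀ e, ∀ a ∈ G.closedParam e, ∀ b ∈ G.closedParam e,
    AbsolutelyContinuousOnInterval (fun s => f (G.point e s)) a b
  h1NormSq_lt_top : G.h1NormSq f < ⊤

/-- `f ∈ H¹₀(G)`: `f ∈ H¹(G)` and `f` vanishes at the outer vertices. -/
def MemH10 (f : EuclideanSpace ℝ (Fin d) → 𝕜) : Prop :=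
  G.MemH1 f ∧ ∀ V ∈ G.outerVertices, f V = 0

/-- The functional `F_{G,p}(f) = ∫_G (|f'|² + |f|²) dx / (∫_G |f|^p dx)^{2/p}`. -/
def quotient (p : ℝ) (f : EuclideanSpace ℝ (Fin d) → 𝕜) : ℝ≥0∞ :=
  G.h1NormSq f / G.massOn p f univ ^ (2 / p)

variable (𝕜) in
/-- The infimum `1 / C_p(G)` of `F_{G,p}` over the nonzero functions of `H¹₀(G)`. -/
def infQuotient (p : ℝ) : ℝ≥0∞ :=
  sInf {r | ∃ f : EuclideanSpace ℝ (Fin d) → 𝕜,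
    G.MemH10 f ∧ (∃ x ∈ G.carrier, f x ≠ 0) ∧ r = G.quotient p f}

/-- A minimising sequence for `F_{G,p}` on `H¹₀(G)`, normalised by `∫_G |v_n|^p dx = 1`. -/
structure IsNormalizedMinimizingSeq (p : ℝ) (v : ℕ → EuclideanSpace ℝ (Fin d) → 𝕜) : Prop where
  memH10 : ∀ n, G.MemH10 (v n)
  mass_eq_one : ∀ n, G.massOn p (v n) univ = 1
  tendsto_quotient : Tendsto (fun n => G.quotient p (v n)) atTop (𝓝 (G.infQuotient 𝕜 p))

/-- The sequence is relatively compact in `H¹₀(G)`: each of its subsequences has a further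
subsequence that converges in the norm of `H¹(G)` to an element of `H¹₀(G)`. -/
def IsRelativelyCompactSeq (v : ℕ → EuclideanSpace ℝ (Fin d) → 𝕜) : Prop :=
  ∀ φ : ℕ → ℕ, StrictMono φ → ∃ ψ : ℕ → ℕ, StrictMono ψ ∧
    ∃ w : EuclideanSpace ℝ (Fin d) → 𝕜, G.MemH10 w ∧
      Tendsto (fun n => G.h1NormSq (v (φ (ψ n)) - w)) atTop (𝓝 0)

end EmbeddedGraph

end

/-! Write I = 1/C_p(G), E for the energy ∫(|f'|² + |f|²) and m for ∫|f|^p. The argument is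
concentration-compactness: vanishing and splitting are excluded, and what remains is concentration
around points x_n, which either escape to infinity or stay bounded.

No vanishing. Since G is connected and leaves every unit ball, |f(x)|² is at most twice the energy
of f in the unit ball around x (`MemH1.ofReal_norm_sq_le_energyOn_ball`). Hence I > 0. As p > 2, a
normalised function of bounded energy cannot be uniformly small, so some unit ball carries energy at
least c, a constant independent of the function (`exists_forall_ofReal_le_energyOn_ball`).

No splitting. Around such a ball, cut f along a wide annulus of small mass. The energies of the
inner and outer pieces add up to almost I, their masses to almost 1, and each piece obeys m ≤
(E/I)^(p/2). Because p/2 > 1, two pieces of non-negligible energy would lose mass; the inner one has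
energy at least c, so the outer one is negligible (`exists_forall_le_of_add_le_of_le_rpow`,
`exists_forall_energyOn_compl_ball_le`). Thus v_n concentrates around points x_n, at a scale
independent of n (`exists_concentration`).

Conclusion. If |x_n| is unbounded, a subsequence of v_n itself, with w_k = v_{n_k}, concentrates at
infinity. If it is bounded, the sequence is tight. Balls have finite length, so along a pointwise
convergent subsequence the mass of v_n + v_m is asymptotically at least 2^p. Hence E(v_n + v_m) is
asymptotically at least 4I, and the parallelogram law forces E(v_n - v_m) → 0; completeness of
H¹₀(G) finishes the proof (`exists_subseq_tendsto_of_tight`). -/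

/-! ### Absolutely continuous functions with values in a normed space -/

section AbsolutelyContinuous

variable {E F : Type*} [NormedAddCommGroup E] [NormedAddCommGroup F] {a b : ℝ}

/-- A function whose increments are dominated by those of an absolutely continuous function is
absolutely continuous. -/
theorem AbsolutelyContinuousOnInterval.of_dist_le {f : ℝ → E} {g : ℝ → F}
    (hg : AbsolutelyContinuousOnInterval g a b)
    (h : ∀ s ∈ uIcc a b, ∀ t ∈ uIcc a b, dist (f s) (f t) ≤ dist (g s) (g t)) :
    AbsolutelyContinuousOnInterval f a b := by
  rw [absolutelyContinuousOnInterval_iff] at hg ⊢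
  intro ε hε
  obtain ⟨δ, hδ, H⟩ := hg ε hε
  refine ⟨δ, hδ, fun I hI hlt => lt_of_le_of_lt (Finset.sum_le_sum fun i hi => ?_) (H I hI hlt)⟩
  exact h _ (hI.1 i hi).1 _ (hI.1 i hi).2

theorem AbsolutelyContinuousOnInterval.norm {f : ℝ → E}
    (hf : AbsolutelyContinuousOnInterval f a b) :
    AbsolutelyContinuousOnInterval (fun t => ‖f t‖) a b :=
  hf.of_dist_le fun s _ t _ => by
    rw [Real.dist_eq, dist_eq_norm]; exact abs_norm_sub_norm_le _ _

theorem IntervalIntegrable.mono_uIcc {f : ℝ → E} {s t : ℝ} (hf : IntervalIntegrable f volume a b)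
    (hs : s ∈ uIcc a b) (ht : t ∈ uIcc a b) : IntervalIntegrable f volume s t :=
  hf.mono_set (uIcc_subset_uIcc hs ht)

variable [NormedSpace ℝ E]

/-- The primitive of `‖g‖` is a scalar majorant of the increments, which reduces absolute continuity
of a vector-valued primitive to the real case. -/
theorem dist_le_dist_integral_norm {f g : ℝ → E} (hg : IntervalIntegrable g volume a b)
    (h : ∀ s ∈ uIcc a b, ∀ t ∈ uIcc a b, f t - f s = ∫ x in s..t, g x) :
    ∀ s ∈ uIcc a b, ∀ t ∈ uIcc a b,
      dist (f s) (f t) ≤ dist (∫ x in a..s, ‖g x‖) (∫ x in a..t, ‖g x‖) := by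
  intro s hs t ht
  have ha : a ∈ uIcc a b := left_mem_uIcc
  rw [dist_comm, dist_eq_norm, h s hs t ht, dist_comm, Real.dist_eq,
    intervalIntegral.integral_interval_sub_left (hg.norm.mono_uIcc ha ht)
      (hg.norm.mono_uIcc ha hs)]
  exact intervalIntegral.norm_integral_le_abs_integral_norm

/-- A function whose increments are the integrals of an integrable function is absolutely
continuous. -/
theorem absolutelyContinuousOnInterval_of_sub_eq_integral {f g : ℝ → E}
    (hg : IntervalIntegrable g volume a b)
    (h : ∀ s ∈ uIcc a b, ∀ t ∈ uIcc a b, f t - f s = ∫ x in s..t, g x) :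
    AbsolutelyContinuousOnInterval f a b :=
  (hg.norm.absolutelyContinuousOnInterval_intervalIntegral left_mem_uIcc).of_dist_le
    (dist_le_dist_integral_norm hg h)

theorem AbsolutelyContinuousOnInterval.ae_differentiableAt_of_finiteDimensional
    [FiniteDimensional ℝ E] {f : ℝ → E} (hf : AbsolutelyContinuousOnInterval f a b) :
    ∀ᵐ x : ℝ, x ∈ uIcc a b → DifferentiableAt ℝ f x :=
  hf.boundedVariationOn.ae_differentiableAt_of_mem_uIcc

theorem sub_eq_intervalIntegral_self {g : ℝ → E} (hg : IntervalIntegrable g volume a b) :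
    ∀ s ∈ uIcc a b, ∀ t ∈ uIcc a b,
      (∫ x in a..t, g x) - (∫ x in a..s, g x) = ∫ x in s..t, g x := fun _ hs _ ht =>
  intervalIntegral.integral_interval_sub_left (hg.mono_uIcc left_mem_uIcc ht)
      (hg.mono_uIcc left_mem_uIcc hs)

variable [CompleteSpace E]

/-- The fundamental theorem of calculus for absolutely continuous functions with values in a
finite-dimensional space. -/
theorem AbsolutelyContinuousOnInterval.integral_deriv_eq_sub_of_finiteDimensional
    [FiniteDimensional ℝ E] {f : ℝ → E} (hf : AbsolutelyContinuousOnInterval f a b)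
    (hd : IntervalIntegrable (deriv f) volume a b) :
    ∫ x in a..b, deriv f x = f b - f a := by
  -- Subtracting the primitive of the derivative leaves an absolutely continuous function with
  -- derivative zero almost everywhere, hence a constant.
  have hac : AbsolutelyContinuousOnInterval (fun x => f x - ∫ t in a..x, deriv f t) a b :=
    hf.fun_sub (absolutelyContinuousOnInterval_of_sub_eq_integral hd
      (sub_eq_intervalIntegral_self hd))
  have hz : ∀ᵐ x, x ∈ uIcc a b →
      HasDerivAt (fun x => f x - ∫ t in a..x, deriv f t) 0 x := by
    filter_upwards [hf.ae_differentiableAt_of_finiteDimensional, hd.ae_hasDerivAt_integral]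
      with x hx₁ hx₂ hx₃
    simpa using (hx₁ hx₃).hasDerivAt.fun_sub (hx₂ hx₃ a left_mem_uIcc)
  obtain ⟨C, hC⟩ := hac.const_of_ae_hasDerivAt_zero hz
  have h₁ := hC a left_mem_uIcc
  have h₂ := hC b right_mem_uIcc
  simp only [intervalIntegral.integral_same, sub_zero] at h₁
  rw [h₁, ← h₂]; abel

/-- Lebesgue differentiation for a function whose increments are integrals. -/
theorem ae_hasDerivAt_of_sub_eq_integral {f g : ℝ → E} (hg : IntervalIntegrable g volume a b)
    (h : ∀ t ∈ uIcc a b, f t - f a = ∫ x in a..t, g x) :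
    ∀ᵐ x, x ∈ Ioo a b → HasDerivAt f (g x) x := by
  filter_upwards [hg.ae_hasDerivAt_integral] with x hx hx'
  have hm : x ∈ uIcc a b := Icc_subset_uIcc (Ioo_subset_Icc_self hx')
  have := (hx hm a left_mem_uIcc).const_add (f a)
  refine this.congr_of_eventuallyEq ?_
  filter_upwards [Ioo_mem_nhds hx'.1 hx'.2] with t ht
  rw [← h t (Icc_subset_uIcc (Ioo_subset_Icc_self ht))]; abel

end AbsolutelyContinuous

/-! ### The graph as a measure space and the algebra of `H¹(G)` -/

namespace EmbeddedGraph

variable {d : ℕ} (G : EmbeddedGraph d) {𝕜 : Type*} [RCLike 𝕜]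

/-- On `G.Edge × ℝ` a sum over edges of integrals becomes a single integral, so that Fatou,
dominated convergence and completeness of L² apply to the whole graph at once. -/
instance : MeasurableSpace G.Edge := ⊤

instance : DiscreteMeasurableSpace G.Edge := ⟨fun _ => trivial⟩

/-- The arc-length parametrisation of all the edges simultaneously. -/
def pt (x : G.Edge × ℝ) : EuclideanSpace ℝ (Fin d) := G.point x.1 x.2

/-- The derivative along the edges. -/
noncomputable def slope (f : EuclideanSpace ℝ (Fin d) → 𝕜) (x : G.Edge × ℝ) : 𝕜 :=
  deriv (fun s => f (G.point x.1 s)) x.2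

/-- The one-dimensional measure of the graph, on the parameters of the edges. -/
noncomputable def edgeMeasure : Measure (G.Edge × ℝ) :=
  Measure.sum fun e => (volume.restrict (G.openParam e)).map (Prod.mk e)

/-- The energy density `|f'|² + |f|²`. -/
noncomputable def dens (f : EuclideanSpace ℝ (Fin d) → 𝕜) (x : G.Edge × ℝ) : ℝ :=
  ‖G.slope f x‖ ^ 2 + ‖f (G.pt x)‖ ^ 2

theorem dens_nonneg (f : EuclideanSpace ℝ (Fin d) → 𝕜) (x : G.Edge × ℝ) : 0 ≤ G.dens f x := by
  unfold dens; positivity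

variable {G}

theorem isOpen_openParam (e : G.Edge) : IsOpen (G.openParam e) := by
  have : G.openParam e = Ioi 0 ∩ ENNReal.ofReal ⁻¹' Iio (G.len e) := rfl
  rw [this]
  exact isOpen_Ioi.inter (isOpen_Iio.preimage ENNReal.continuous_ofReal)

theorem openParam_subset_closedParam (e : G.Edge) : G.openParam e ⊆ G.closedParam e :=
  fun _ ht => ⟨ht.1.le, ht.2.le⟩

theorem ordConnected_closedParam (e : G.Edge) : (G.closedParam e).OrdConnected :=
  ⟨fun _ ha _ hb _ ht =>
    ⟨ha.1.trans ht.1, (ENNReal.ofReal_le_ofReal ht.2).trans hb.2⟩⟩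

theorem Ioo_subset_openParam {e : G.Edge} {a b : ℝ} (ha : a ∈ G.closedParam e)
    (hb : b ∈ G.closedParam e) : Ioo a b ⊆ G.openParam e := fun _ ht =>
  ⟨ha.1.trans_lt ht.1, lt_of_lt_of_le
    ((ENNReal.ofReal_lt_ofReal_iff ((ha.1.trans_lt ht.1).trans ht.2)).2 ht.2) hb.2⟩

theorem zero_mem_closedParam (e : G.Edge) : (0 : ℝ) ∈ G.closedParam e := by
  simp [closedParam]

theorem point_mem_carrier {e : G.Edge} {t : ℝ} (ht : t ∈ G.closedParam e) :
    G.point e t ∈ G.carrier := mem_iUnion.2 ⟨e, mem_image_of_mem _ ht⟩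

theorem pt_mem_carrier {x : G.Edge × ℝ} (hx : x.2 ∈ G.openParam x.1) : G.pt x ∈ G.carrier :=
  point_mem_carrier (openParam_subset_closedParam _ hx)

/-- Because edges are straight with unit direction, Lipschitz cut-offs on the ambient space restrict
to cut-offs on edges with the same constant. -/
theorem dist_point (e : G.Edge) (s t : ℝ) : dist (G.point e s) (G.point e t) = dist s t := by
  simp [point, dist_eq_norm, ← sub_smul, norm_smul, G.norm_dir]

theorem isometry_point (e : G.Edge) : Isometry (G.point e) := Isometry.of_dist_eq (dist_point e)

theorem measurable_pt [Countable G.Edge] : Measurable G.pt :=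
  measurable_from_prod_countable_right fun e => (isometry_point e).continuous.measurable

theorem measurableEmbedding_mk (e : G.Edge) : MeasurableEmbedding (Prod.mk e : ℝ → G.Edge × ℝ) :=
  MeasurableEmbedding.id.prodMk_left e

theorem ae_edgeMeasure_iff [Countable G.Edge] {P : G.Edge × ℝ → Prop} :
    (∀ᵐ x ∂G.edgeMeasure, P x) ↔ ∀ e, ∀ᵐ t ∂volume.restrict (G.openParam e), P (e, t) := by
  rw [edgeMeasure, Measure.ae_sum_iff]
  simp_rw [(measurableEmbedding_mk _).ae_map_iff]

theorem aestronglyMeasurable_edgeMeasure [Countable G.Edge] {H : G.Edge × ℝ → 𝕜}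
    (h : ∀ e, AEStronglyMeasurable (fun t => H (e, t)) (volume.restrict (G.openParam e))) :
    AEStronglyMeasurable H G.edgeMeasure :=
  AEStronglyMeasurable.sum_measure fun e =>
    (measurableEmbedding_mk e).aestronglyMeasurable_map_iff.2 (h e)

theorem setLIntegral_edgeMeasure [Countable G.Edge] (H : G.Edge × ℝ → ℝ≥0∞)
    {A : Set (EuclideanSpace ℝ (Fin d))} (hA : MeasurableSet A) :
    ∫⁻ x in G.pt ⁻¹' A, H x ∂G.edgeMeasure =
      ∑' e, ∫⁻ t in G.openParam e ∩ G.point e ⁻¹' A, H (e, t) := by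
  rw [edgeMeasure, Measure.restrict_sum _ (measurable_pt hA), lintegral_sum_measure]
  refine tsum_congr fun e => ?_
  rw [(measurableEmbedding_mk e).restrict_map, (measurableEmbedding_mk e).lintegral_map,
    Measure.restrict_restrict ((measurableEmbedding_mk e).measurable (measurable_pt hA)),
    inter_comm]
  rfl

theorem ae_mem_openParam [Countable G.Edge] : ∀ᵐ x ∂G.edgeMeasure, x.2 ∈ G.openParam x.1 :=
  ae_edgeMeasure_iff.2 fun e => ae_restrict_mem (isOpen_openParam e).measurableSet

theorem ofReal_dens (f : EuclideanSpace ℝ (Fin d) → 𝕜) (x : G.Edge × ℝ) :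
    ENNReal.ofReal (G.dens f x) = ‖G.slope f x‖ₑ ^ 2 + ‖f (G.pt x)‖ₑ ^ 2 := by
  rw [dens, ENNReal.ofReal_add (by positivity) (by positivity),
    ENNReal.ofReal_pow (norm_nonneg _), ENNReal.ofReal_pow (norm_nonneg _), ofReal_norm,
    ofReal_norm]

theorem energyOn_eq [Countable G.Edge] (f : EuclideanSpace ℝ (Fin d) → 𝕜)
    {A : Set (EuclideanSpace ℝ (Fin d))} (hA : MeasurableSet A) :
    G.energyOn f A = ∫⁻ x in G.pt ⁻¹' A, ENNReal.ofReal (G.dens f x) ∂G.edgeMeasure := by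
  rw [setLIntegral_edgeMeasure _ hA]
  simp_rw [ofReal_dens]
  rfl

theorem h1NormSq_eq [Countable G.Edge] (f : EuclideanSpace ℝ (Fin d) → 𝕜) :
    G.h1NormSq f = ∫⁻ x, ENNReal.ofReal (G.dens f x) ∂G.edgeMeasure := by
  rw [h1NormSq, energyOn_eq f MeasurableSet.univ, preimage_univ, Measure.restrict_univ]

theorem ofReal_norm_rpow {p : ℝ} (hp : 0 ≤ p) (z : 𝕜) :
    ENNReal.ofReal (‖z‖ ^ p) = ‖z‖ₑ ^ p := by
  rw [← ENNReal.ofReal_rpow_of_nonneg (norm_nonneg _) hp, ofReal_norm]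

theorem massOn_eq [Countable G.Edge] {p : ℝ} (hp : 0 ≤ p) (f : EuclideanSpace ℝ (Fin d) → 𝕜)
    {A : Set (EuclideanSpace ℝ (Fin d))} (hA : MeasurableSet A) :
    G.massOn p f A = ∫⁻ x in G.pt ⁻¹' A, ENNReal.ofReal (‖f (G.pt x)‖ ^ p) ∂G.edgeMeasure := by
  rw [setLIntegral_edgeMeasure _ hA]
  simp_rw [ofReal_norm_rpow hp]
  rfl

theorem massOn_univ_eq [Countable G.Edge] {p : ℝ} (hp : 0 ≤ p)
    (f : EuclideanSpace ℝ (Fin d) → 𝕜) :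
    G.massOn p f univ = ∫⁻ x, ENNReal.ofReal (‖f (G.pt x)‖ ^ p) ∂G.edgeMeasure := by
  rw [massOn_eq hp f MeasurableSet.univ, preimage_univ, Measure.restrict_univ]

theorem IsLocallyFinite.countable_edge (h : G.IsLocallyFinite) : Countable G.Edge := by
  have := LocallyFinite.countable_univ h
    fun e => ⟨G.point e 0, mem_image_of_mem _ (zero_mem_closedParam e)⟩
  exact countable_univ_iff.1 this

/-- Properties that hold almost everywhere on every compact part of an edge hold almost
everywhere. -/
theorem ae_restrict_openParam {e : G.Edge} {P : ℝ → Prop}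
    (h : ∀ b ∈ G.closedParam e, ∀ᵐ t : ℝ, t ∈ Ioo 0 b → P t) :
    ∀ᵐ t ∂volume.restrict (G.openParam e), P t := by
  rw [ae_restrict_iff' (isOpen_openParam e).measurableSet]
  -- Rational endpoints keep the number of exceptional null sets countable; every point of the open
  -- edge lies below some rational that is still in the edge.
  have h' : ∀ q : ℚ, ∀ᵐ t : ℝ, (q : ℝ) ∈ G.closedParam e → t ∈ Ioo 0 (q : ℝ) → P t := fun q => by
    by_cases hq : (q : ℝ) ∈ G.closedParam e
    · filter_upwards [h q hq] with t ht _ using ht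
    · exact Eventually.of_forall fun t ht => absurd ht hq
  filter_upwards [ae_all_iff.2 h'] with t ht hto
  obtain ⟨ε, hε, hball⟩ := Metric.isOpen_iff.1 (isOpen_openParam e) t hto
  obtain ⟨q, hq, hq'⟩ := exists_rat_btwn (show t < t + ε by linarith)
  refine ht q (openParam_subset_closedParam e (hball ?_)) ⟨hto.1, hq⟩
  rw [Metric.mem_ball, Real.dist_eq, abs_of_pos] <;> linarith

variable {f g : EuclideanSpace ℝ (Fin d) → 𝕜}

theorem ae_restrict_differentiableAt {e : G.Edge} {E : Type*} [NormedAddCommGroup E]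
    [NormedSpace ℝ E] [FiniteDimensional ℝ E] {u : ℝ → E}
    (h : ∀ b ∈ G.closedParam e, AbsolutelyContinuousOnInterval u 0 b) :
    ∀ᵐ t ∂volume.restrict (G.openParam e), DifferentiableAt ℝ u t :=
  ae_restrict_openParam fun b hb => by
    filter_upwards [(h b hb).ae_differentiableAt_of_finiteDimensional] with t ht hto
    exact ht (Icc_subset_uIcc (Ioo_subset_Icc_self hto))

theorem MemH1.ae_differentiableAt [Countable G.Edge] (hf : G.MemH1 f) :
    ∀ᵐ x ∂G.edgeMeasure, DifferentiableAt ℝ (fun s => f (G.point x.1 s)) x.2 :=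
  ae_edgeMeasure_iff.2 fun e => ae_restrict_differentiableAt fun b hb =>
    hf.absolutelyContinuous e 0 (zero_mem_closedParam e) b hb

theorem continuousOn_comp_point (hf : ContinuousOn f G.carrier) (e : G.Edge) :
    ContinuousOn (fun t => f (G.point e t)) (G.closedParam e) :=
  hf.comp (isometry_point e).continuous.continuousOn fun _ ht => point_mem_carrier ht

theorem aestronglyMeasurable_comp_pt [Countable G.Edge] (hf : ContinuousOn f G.carrier) :
    AEStronglyMeasurable (fun x => f (G.pt x)) G.edgeMeasure :=
  aestronglyMeasurable_edgeMeasure fun e =>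
    ((continuousOn_comp_point hf e).mono (openParam_subset_closedParam e)).aestronglyMeasurable
      (isOpen_openParam e).measurableSet

theorem aestronglyMeasurable_slope [Countable G.Edge] (f : EuclideanSpace ℝ (Fin d) → 𝕜) :
    AEStronglyMeasurable (G.slope f) G.edgeMeasure :=
  aestronglyMeasurable_edgeMeasure fun e =>
    (stronglyMeasurable_deriv fun s => f (G.point e s)).aestronglyMeasurable

theorem aemeasurable_dens [Countable G.Edge] (hf : ContinuousOn f G.carrier) :
    AEMeasurable (fun x => ENNReal.ofReal (G.dens f x)) G.edgeMeasure :=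
  (((aestronglyMeasurable_slope f).norm.aemeasurable.pow_const 2).add
    ((aestronglyMeasurable_comp_pt hf).norm.aemeasurable.pow_const 2)).ennreal_ofReal

theorem aemeasurable_norm_rpow [Countable G.Edge] (hf : ContinuousOn f G.carrier) (p : ℝ) :
    AEMeasurable (fun x => ENNReal.ofReal (‖f (G.pt x)‖ ^ p)) G.edgeMeasure :=
  ((aestronglyMeasurable_comp_pt hf).norm.aemeasurable.pow_const p).ennreal_ofReal

theorem MemH1.ae_slope_add [Countable G.Edge] (hf : G.MemH1 f) (hg : G.MemH1 g) :
    ∀ᵐ x ∂G.edgeMeasure, G.slope (f + g) x = G.slope f x + G.slope g x := by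
  filter_upwards [hf.ae_differentiableAt, hg.ae_differentiableAt] with x h₁ h₂
  exact deriv_fun_add h₁ h₂

theorem MemH1.ae_slope_sub [Countable G.Edge] (hf : G.MemH1 f) (hg : G.MemH1 g) :
    ∀ᵐ x ∂G.edgeMeasure, G.slope (f - g) x = G.slope f x - G.slope g x := by
  filter_upwards [hf.ae_differentiableAt, hg.ae_differentiableAt] with x h₁ h₂
  exact deriv_fun_sub h₁ h₂

theorem parallelogram {z w : 𝕜} :
    ‖z + w‖ ^ 2 + ‖z - w‖ ^ 2 = 2 * ‖z‖ ^ 2 + 2 * ‖w‖ ^ 2 := by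
  have := parallelogram_law_with_norm ℝ z w
  nlinarith [this]

theorem MemH1.ae_dens_parallelogram [Countable G.Edge] (hf : G.MemH1 f) (hg : G.MemH1 g) :
    ∀ᵐ x ∂G.edgeMeasure,
      G.dens (f + g) x + G.dens (f - g) x = 2 * G.dens f x + 2 * G.dens g x := by
  filter_upwards [hf.ae_slope_add hg, hf.ae_slope_sub hg] with x h₁ h₂
  have h₃ := parallelogram (z := G.slope f x) (w := G.slope g x)
  have h₄ := parallelogram (z := f (G.pt x)) (w := g (G.pt x))
  simp only [dens, h₁, h₂, Pi.add_apply, Pi.sub_apply]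
  linarith

/-- Dropping one term on the left shows that sums and differences have finite energy; the full
identity is what makes tight minimising sequences Cauchy. -/
theorem MemH1.h1NormSq_parallelogram [Countable G.Edge] (hf : G.MemH1 f) (hg : G.MemH1 g) :
    G.h1NormSq (f + g) + G.h1NormSq (f - g) = 2 * G.h1NormSq f + 2 * G.h1NormSq g := by
  simp only [h1NormSq_eq]
  rw [← lintegral_add_left' (aemeasurable_dens (hf.continuousOn.add hg.continuousOn)),
    ← lintegral_const_mul' _ _ (by simp), ← lintegral_const_mul' _ _ (by simp),
    ← lintegral_add_left' ((aemeasurable_dens hf.continuousOn).const_mul _)]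
  refine lintegral_congr_ae ?_
  filter_upwards [hf.ae_dens_parallelogram hg] with x hx
  have := G.dens_nonneg (𝕜 := 𝕜)
  rw [← ENNReal.ofReal_add (this _ _) (this _ _), hx,
    ENNReal.ofReal_add (by linarith [this f x]) (by linarith [this g x]),
    ENNReal.ofReal_mul (by norm_num), ENNReal.ofReal_mul (by norm_num)]
  simp

theorem MemH1.add [Countable G.Edge] (hf : G.MemH1 f) (hg : G.MemH1 g) : G.MemH1 (f + g) where
  continuousOn := hf.continuousOn.add hg.continuousOn
  absolutelyContinuous e a ha b hb :=
    (hf.absolutelyContinuous e a ha b hb).fun_add (hg.absolutelyContinuous e a ha b hb)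
  h1NormSq_lt_top := by
    refine lt_of_le_of_lt le_self_add ((hf.h1NormSq_parallelogram hg).trans_lt ?_)
    exact ENNReal.add_lt_top.2 ⟨ENNReal.mul_lt_top (by simp) hf.h1NormSq_lt_top,
      ENNReal.mul_lt_top (by simp) hg.h1NormSq_lt_top⟩

theorem MemH1.sub [Countable G.Edge] (hf : G.MemH1 f) (hg : G.MemH1 g) : G.MemH1 (f - g) where
  continuousOn := hf.continuousOn.sub hg.continuousOn
  absolutelyContinuous e a ha b hb :=
    (hf.absolutelyContinuous e a ha b hb).fun_sub (hg.absolutelyContinuous e a ha b hb)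
  h1NormSq_lt_top := by
    refine lt_of_le_of_lt le_add_self ((hf.h1NormSq_parallelogram hg).trans_lt ?_)
    exact ENNReal.add_lt_top.2 ⟨ENNReal.mul_lt_top (by simp) hf.h1NormSq_lt_top,
      ENNReal.mul_lt_top (by simp) hg.h1NormSq_lt_top⟩

theorem MemH10.add [Countable G.Edge] (hf : G.MemH10 f) (hg : G.MemH10 g) : G.MemH10 (f + g) :=
  ⟨hf.1.add hg.1, fun V hV => by simp [hf.2 V hV, hg.2 V hV]⟩

/-! ### Lipschitz cut-offs -/

section Cutoff

variable {ψ : EuclideanSpace ℝ (Fin d) → ℝ} {K : NNReal}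

theorem lipschitzWith_comp_point (hψ : LipschitzWith K ψ) (e : G.Edge) :
    LipschitzWith K fun t => ψ (G.point e t) := by
  simpa [Function.comp_def] using hψ.comp (isometry_point e).lipschitz

theorem absolutelyContinuous_cutoff (hf : G.MemH1 f) (hψ : LipschitzWith K ψ) {e : G.Edge}
    {a b : ℝ} (ha : a ∈ G.closedParam e) (hb : b ∈ G.closedParam e) :
    AbsolutelyContinuousOnInterval (fun t => ψ (G.point e t) • f (G.point e t)) a b :=
  ((lipschitzWith_comp_point hψ e).lipschitzOnWith.absolutelyContinuousOnInterval).fun_smul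
    (hf.absolutelyContinuous e a ha b hb)

theorem MemH1.ae_norm_slope_cutoff_le [Countable G.Edge] (hf : G.MemH1 f)
    (hψ : LipschitzWith K ψ) :
    ∀ᵐ x ∂G.edgeMeasure, ‖G.slope (fun y => ψ y • f y) x‖ ≤
      |ψ (G.pt x)| * ‖G.slope f x‖ + K * ‖f (G.pt x)‖ := by
  have hd : ∀ᵐ x ∂G.edgeMeasure, DifferentiableAt ℝ (fun s => ψ (G.point x.1 s)) x.2 :=
    ae_edgeMeasure_iff.2 fun e =>
      ae_restrict_of_ae (lipschitzWith_comp_point hψ e).ae_differentiableAt_of_real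
  filter_upwards [hf.ae_differentiableAt, hd] with x h₁ h₂
  have : G.slope (fun y => ψ y • f y) x = ψ (G.pt x) • G.slope f x +
      deriv (fun s => ψ (G.point x.1 s)) x.2 • f (G.pt x) := deriv_fun_smul h₂ h₁
  rw [this]
  refine (norm_add_le _ _).trans ?_
  rw [norm_smul, norm_smul, Real.norm_eq_abs]
  gcongr
  exact norm_deriv_le_of_lipschitz (lipschitzWith_comp_point hψ x.1)

/-- The cross term 2ψK|f'||f| of the product rule is absorbed by 2|f'||f| ≤ |f'|² + |f|². The factor
ψ² is kept so that ψ² + (1 - ψ)² ≤ 1 can be used when the bounds for ψ and 1 - ψ are added. -/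
theorem MemH1.ae_dens_cutoff_le [Countable G.Edge] (hf : G.MemH1 f) (hψ : LipschitzWith K ψ)
    (h0 : ∀ y, 0 ≤ ψ y) :
    ∀ᵐ x ∂G.edgeMeasure, G.dens (fun y => ψ y • f y) x ≤
      ψ (G.pt x) ^ 2 * G.dens f x + K ^ 2 * ‖f (G.pt x)‖ ^ 2 + ψ (G.pt x) * K * G.dens f x := by
  filter_upwards [hf.ae_norm_slope_cutoff_le hψ] with x hx
  rw [abs_of_nonneg (h0 _)] at hx
  have h1 : ‖G.slope (fun y => ψ y • f y) x‖ ^ 2 ≤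
      (ψ (G.pt x) * ‖G.slope f x‖ + K * ‖f (G.pt x)‖) ^ 2 := by gcongr
  have h2 : 0 ≤ ψ (G.pt x) * K * (‖G.slope f x‖ - ‖f (G.pt x)‖) ^ 2 :=
    mul_nonneg (mul_nonneg (h0 _) K.2) (sq_nonneg _)
  have h3 : ‖ψ (G.pt x) • f (G.pt x)‖ ^ 2 = ψ (G.pt x) ^ 2 * ‖f (G.pt x)‖ ^ 2 := by
    rw [norm_smul, Real.norm_eq_abs, mul_pow, sq_abs]
  unfold dens
  rw [h3]
  nlinarith

theorem MemH10.cutoff [Countable G.Edge] (hf : G.MemH10 f) (hψ : LipschitzWith K ψ)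
    (h0 : ∀ y, 0 ≤ ψ y) (h1 : ∀ y, ψ y ≤ 1) : G.MemH10 fun y => ψ y • f y where
  left :=
    { continuousOn := hψ.continuous.continuousOn.smul hf.1.continuousOn
      absolutelyContinuous := fun _ _ ha _ hb => absolutelyContinuous_cutoff hf.1 hψ ha hb
      h1NormSq_lt_top := by
        have hlt := hf.1.h1NormSq_lt_top
        rw [h1NormSq_eq] at hlt ⊢
        have hle : ∀ᵐ x ∂G.edgeMeasure, ENNReal.ofReal (G.dens (fun y => ψ y • f y) x) ≤
            ENNReal.ofReal (1 + (K : ℝ) ^ 2 + K) * ENNReal.ofReal (G.dens f x) := by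
          filter_upwards [hf.1.ae_dens_cutoff_le hψ h0] with x hx
          rw [← ENNReal.ofReal_mul (by positivity)]
          refine ENNReal.ofReal_le_ofReal (hx.trans ?_)
          have hd := G.dens_nonneg f x
          have hK : (0 : ℝ) ≤ K := K.2
          have a1 : ψ (G.pt x) ^ 2 * G.dens f x ≤ 1 * G.dens f x := by
            gcongr
            exact pow_le_one₀ (h0 _) (h1 _)
          have a2 : ψ (G.pt x) * K * G.dens f x ≤ 1 * K * G.dens f x := by
            gcongr
            exact h1 _
          have a3 : (K : ℝ) ^ 2 * ‖f (G.pt x)‖ ^ 2 ≤ (K : ℝ) ^ 2 * G.dens f x := by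
            gcongr
            exact le_add_of_nonneg_left (by positivity)
          linarith
        refine (lintegral_mono_ae hle).trans_lt ?_
        rw [lintegral_const_mul' _ _ ENNReal.ofReal_ne_top]
        exact ENNReal.mul_lt_top ENNReal.ofReal_lt_top hlt }
  right V hV := by simp [hf.2 V hV]

end Cutoff

end EmbeddedGraph

namespace EmbeddedGraph

variable {d : ℕ} {G : EmbeddedGraph d} {𝕜 : Type*} [RCLike 𝕜]
  {f : EuclideanSpace ℝ (Fin d) → 𝕜}

/-! ### The Sobolev inequality -/

/-- The product rule gives at most |u|² + 2|u||u'|, and 2|u||u'| ≤ |u|² + |u'|². -/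
theorem abs_deriv_mul_norm_sq_le {ψ : ℝ → ℝ} {u : ℝ → 𝕜} {t : ℝ} (hψ : DifferentiableAt ℝ ψ t)
    (hu : DifferentiableAt ℝ u t) (h0 : 0 ≤ ψ t) (h1 : ψ t ≤ 1) (h' : |deriv ψ t| ≤ 1) :
    |deriv (fun s => ψ s * ‖u s‖ ^ 2) t| ≤ 2 * (‖deriv u t‖ ^ 2 + ‖u t‖ ^ 2) := by
  rw [(hψ.hasDerivAt.fun_mul hu.hasDerivAt.norm_sq).deriv]
  have h2 := abs_real_inner_le_norm (u t) (deriv u t)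
  have h3 : |deriv ψ t * ‖u t‖ ^ 2| ≤ 1 * ‖u t‖ ^ 2 := by
    rw [abs_mul, abs_of_nonneg (sq_nonneg ‖u t‖)]
    gcongr
  have h4 : |ψ t * (2 * inner ℝ (u t) (deriv u t))| ≤ 1 * (2 * (‖u t‖ * ‖deriv u t‖)) := by
    rw [abs_mul, abs_of_nonneg h0, abs_mul, abs_two]
    gcongr
  have h5 := abs_add_le (deriv ψ t * ‖u t‖ ^ 2) (ψ t * (2 * inner ℝ (u t) (deriv u t)))
  nlinarith [sq_nonneg (‖u t‖ - ‖deriv u t‖), sq_nonneg ‖deriv u t‖]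

/-- The tent function of radius `1` around `x`. -/
noncomputable def tent (x y : EuclideanSpace ℝ (Fin d)) : ℝ := max (1 - dist y x) 0

theorem lipschitzWith_tent (x : EuclideanSpace ℝ (Fin d)) : LipschitzWith 1 (tent x) := by
  have h : LipschitzWith 1 fun y : EuclideanSpace ℝ (Fin d) => 1 - dist y x :=
    LipschitzWith.of_dist_le_mul fun y z => by
      rw [Real.dist_eq, NNReal.coe_one, one_mul,
        show 1 - dist y x - (1 - dist z x) = dist z x - dist y x by ring, dist_comm y z]
      exact abs_dist_sub_le _ _ _
  exact h.max_const 0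

theorem tent_nonneg (x y : EuclideanSpace ℝ (Fin d)) : 0 ≤ tent x y := le_max_right _ _

theorem tent_le_one (x y : EuclideanSpace ℝ (Fin d)) : tent x y ≤ 1 :=
  max_le (by linarith [dist_nonneg (x := y) (y := x)]) zero_le_one

theorem tent_eq_zero {x y : EuclideanSpace ℝ (Fin d)} (h : 1 ≤ dist y x) : tent x y = 0 :=
  max_eq_right (by linarith)

/-- The right-hand side does not depend on the two parameters, so it bounds the diameter of the
image of the whole edge under the localised function. -/
theorem MemH1.edist_tent_mul_norm_sq_le (hf : G.MemH1 f) (x : EuclideanSpace ℝ (Fin d))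
    (e : G.Edge) {s t : ℝ} (hs : s ∈ G.closedParam e) (ht : t ∈ G.closedParam e) (hst : s ≤ t) :
    edist (tent x (G.point e s) * ‖f (G.point e s)‖ ^ 2)
        (tent x (G.point e t) * ‖f (G.point e t)‖ ^ 2) ≤
      ∫⁻ r in G.openParam e ∩ G.point e ⁻¹' Metric.ball x 1,
        ENNReal.ofReal (2 * G.dens f (e, r)) := by
  set u : ℝ → ℝ := fun r => tent x (G.point e r) * ‖f (G.point e r)‖ ^ 2 with hu
  have hψ := lipschitzWith_comp_point (lipschitzWith_tent x) e
  have hac : ∀ a ∈ G.closedParam e, ∀ b ∈ G.closedParam e,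
      AbsolutelyContinuousOnInterval u a b := fun a ha b hb => by
    have h1 := (hf.absolutelyContinuous e a ha b hb).norm
    have h2 := (hψ.lipschitzOnWith (s := uIcc a b)).absolutelyContinuousOnInterval.fun_mul
      (h1.fun_mul h1)
    simpa only [hu, pow_two] using h2
  have hbound : ∀ᵐ r ∂volume.restrict (G.openParam e), ‖deriv u r‖ₑ ≤
      (G.point e ⁻¹' Metric.ball x 1).indicator
        (fun r => ENNReal.ofReal (2 * G.dens f (e, r))) r := by
    have hd : ∀ᵐ r ∂volume.restrict (G.openParam e),
        DifferentiableAt ℝ (fun s => f (G.point e s)) r :=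
      ae_restrict_differentiableAt fun b hb =>
        hf.absolutelyContinuous e 0 (zero_mem_closedParam e) b hb
    filter_upwards [hd, ae_restrict_of_ae hψ.ae_differentiableAt_of_real] with r h₁ h₂
    by_cases hr : r ∈ G.point e ⁻¹' Metric.ball x 1
    · rw [indicator_of_mem hr, ← ofReal_norm, Real.norm_eq_abs]
      refine ENNReal.ofReal_le_ofReal (abs_deriv_mul_norm_sq_le h₂ h₁ (tent_nonneg _ _)
        (tent_le_one _ _) ?_)
      simpa using norm_deriv_le_of_lipschitz (x₀ := r) hψ
    · have h0 : u r = 0 := by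
        simp only [hu]
        rw [tent_eq_zero (by simpa using hr), zero_mul]
      -- Outside the open ball the nonnegative function is at its minimum 0, so its derivative
      -- vanishes there, on the sphere as well.
      have hmin : IsLocalMin u r := Eventually.of_forall fun r' => by
        rw [h0]
        exact mul_nonneg (tent_nonneg _ _) (by positivity)
      simp [hmin.deriv_eq_zero]
  calc edist (u s) (u t) = ‖∫ r in s..t, deriv u r‖ₑ := by
        rw [(hac s hs t ht).integral_deriv_eq_sub, edist_comm, edist_eq_enorm_sub]
    _ ≤ ∫⁻ r in Ioc s t, ‖deriv u r‖ₑ := by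
        rw [intervalIntegral.integral_of_le hst]
        exact enorm_integral_le_lintegral_enorm _
    _ = ∫⁻ r in Ioo s t, ‖deriv u r‖ₑ := setLIntegral_congr Ioo_ae_eq_Ioc.symm
    _ ≤ ∫⁻ r in G.openParam e, ‖deriv u r‖ₑ :=
        lintegral_mono_set (Ioo_subset_openParam hs ht)
    _ ≤ ∫⁻ r in G.openParam e, (G.point e ⁻¹' Metric.ball x 1).indicator
        (fun r => ENNReal.ofReal (2 * G.dens f (e, r))) r := lintegral_mono_ae hbound
    _ = _ := by
        have hm : MeasurableSet (G.point e ⁻¹' Metric.ball x 1) :=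
          (isometry_point e).continuous.measurable measurableSet_ball
        rw [lintegral_indicator hm, Measure.restrict_restrict hm, inter_comm]

theorem exists_one_le_dist (hunb : G.IsUnbounded) (x : EuclideanSpace ℝ (Fin d)) :
    ∃ y ∈ G.carrier, 1 ≤ dist y x := by
  by_contra! h
  exact hunb (Metric.isBounded_ball.subset fun y hy => Metric.mem_ball.2 (h y hy))

/-- The local Sobolev inequality on a connected unbounded graph. -/
theorem MemH1.ofReal_norm_sq_le_energyOn_ball [Countable G.Edge] (hconn : IsConnected G.carrier)
    (hunb : G.IsUnbounded) (hf : G.MemH1 f) {x : EuclideanSpace ℝ (Fin d)} (hx : x ∈ G.carrier) :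
    ENNReal.ofReal (‖f x‖ ^ 2) ≤ 2 * G.energyOn f (Metric.ball x 1) := by
  set g : EuclideanSpace ℝ (Fin d) → ℝ := fun y => tent x y * ‖f y‖ ^ 2 with hg
  have hgc : ContinuousOn g G.carrier :=
    (lipschitzWith_tent x).continuous.continuousOn.mul (hf.continuousOn.norm.pow 2)
  obtain ⟨y, hy, hyx⟩ := exists_one_le_dist hunb x
  have hgx : g x = ‖f x‖ ^ 2 := by simp [hg, tent]
  have hgy : g y = 0 := by simp [hg, tent_eq_zero hyx]
  -- The image of the connected graph contains the interval from 0 to |f(x)|² and is covered by the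
  -- images of the countably many edges. Comparing lengths replaces integration along a path from x
  -- out of the ball.
  have hsub : Icc 0 (‖f x‖ ^ 2) ⊆ ⋃ e, g '' G.closedEdge e := by
    rw [← image_iUnion, ← hgx, ← hgy]
    exact (hconn.isPreconnected.image g hgc).Icc_subset (mem_image_of_mem g hy)
      (mem_image_of_mem g hx)
  calc ENNReal.ofReal (‖f x‖ ^ 2) = volume (Icc 0 (‖f x‖ ^ 2)) := by simp
    _ ≤ ∑' e, volume (g '' G.closedEdge e) := (measure_mono hsub).trans (measure_iUnion_le _)
    _ ≤ ∑' e, ∫⁻ r in G.openParam e ∩ G.point e ⁻¹' Metric.ball x 1,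
        ENNReal.ofReal (2 * G.dens f (e, r)) := by
        refine ENNReal.tsum_le_tsum fun e => (Real.volume_le_diam _).trans (Metric.ediam_le ?_)
        rintro _ ⟨_, ⟨s, hs, rfl⟩, rfl⟩ _ ⟨_, ⟨t, ht, rfl⟩, rfl⟩
        rcases le_total s t with hst | hst
        · exact hf.edist_tent_mul_norm_sq_le x e hs ht hst
        · rw [edist_comm]
          exact hf.edist_tent_mul_norm_sq_le x e ht hs hst
    _ = 2 * G.energyOn f (Metric.ball x 1) := by
        rw [← setLIntegral_edgeMeasure (fun x => ENNReal.ofReal (2 * G.dens f x))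
          measurableSet_ball, energyOn_eq f measurableSet_ball, ← lintegral_const_mul' _ _ (by simp)]
        simp [ENNReal.ofReal_mul]

theorem energyOn_mono (f : EuclideanSpace ℝ (Fin d) → 𝕜)
    {A B : Set (EuclideanSpace ℝ (Fin d))} (h : A ⊆ B) : G.energyOn f A ≤ G.energyOn f B :=
  ENNReal.tsum_le_tsum fun _ =>
    lintegral_mono_set (inter_subset_inter_right _ (preimage_mono h))

theorem MemH1.norm_sq_le [Countable G.Edge] (hconn : IsConnected G.carrier)
    (hunb : G.IsUnbounded) (hf : G.MemH1 f) {x : EuclideanSpace ℝ (Fin d)} (hx : x ∈ G.carrier) :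
    ‖f x‖ ^ 2 ≤ 2 * (G.h1NormSq f).toReal := by
  have h := (hf.ofReal_norm_sq_le_energyOn_ball hconn hunb hx).trans
    (mul_le_mul_right (energyOn_mono f (subset_univ _)) 2)
  have h2 := ENNReal.toReal_mono (ENNReal.mul_ne_top (by simp) hf.h1NormSq_lt_top.ne) h
  rwa [ENNReal.toReal_ofReal (by positivity), ENNReal.toReal_mul, ENNReal.toReal_ofNat] at h2

/-- If `|f| ^ 2 ≤ S` on the graph, then `∫ |f| ^ p ≤ S ^ (p / 2 - 1) * ∫ (|f'| ^ 2 + |f| ^ 2)`. -/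
theorem massOn_le_of_norm_sq_le [Countable G.Edge] {p : ℝ} (hp : 2 < p) {S : ℝ}
    (hS : ∀ x ∈ G.carrier, ‖f x‖ ^ 2 ≤ S) :
    G.massOn p f univ ≤ ENNReal.ofReal (S ^ (p / 2 - 1)) * G.h1NormSq f := by
  rw [massOn_univ_eq (by linarith), h1NormSq_eq, ← lintegral_const_mul' _ _ ENNReal.ofReal_ne_top]
  refine lintegral_mono_ae ?_
  filter_upwards [ae_mem_openParam] with x hx
  have hSx := hS _ (pt_mem_carrier hx)
  have hS0 : 0 ≤ S := (by positivity : (0 : ℝ) ≤ ‖f (G.pt x)‖ ^ 2).trans hSx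
  rw [← ENNReal.ofReal_mul (by positivity)]
  refine ENNReal.ofReal_le_ofReal ?_
  have h1 : ‖f (G.pt x)‖ ^ p = (‖f (G.pt x)‖ ^ 2) ^ (p / 2 - 1) * ‖f (G.pt x)‖ ^ 2 := by
    rw [← Real.rpow_natCast, ← Real.rpow_mul (norm_nonneg _),
      ← Real.rpow_add_of_nonneg (norm_nonneg _) (by push_cast; linarith) (by norm_num)]
    congr 1
    push_cast
    ring
  rw [h1]
  gcongr
  · linarith
  · exact le_add_of_nonneg_left (by positivity)

theorem MemH1.massOn_le [Countable G.Edge] (hconn : IsConnected G.carrier)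
    (hunb : G.IsUnbounded) {p : ℝ} (hp : 2 < p) (hf : G.MemH1 f) :
    G.massOn p f univ ≤ ENNReal.ofReal ((2 * (G.h1NormSq f).toReal) ^ (p / 2)) := by
  refine (massOn_le_of_norm_sq_le hp fun x hx => hf.norm_sq_le hconn hunb hx).trans ?_
  nth_rw 2 [← ENNReal.ofReal_toReal hf.h1NormSq_lt_top.ne]
  rw [← ENNReal.ofReal_mul (by positivity)]
  refine ENNReal.ofReal_le_ofReal ?_
  have h0 : 0 ≤ (G.h1NormSq f).toReal := ENNReal.toReal_nonneg
  calc (2 * (G.h1NormSq f).toReal) ^ (p / 2 - 1) * (G.h1NormSq f).toReal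
      ≤ (2 * (G.h1NormSq f).toReal) ^ (p / 2 - 1) * (2 * (G.h1NormSq f).toReal) ^ (1 : ℝ) := by
        rw [Real.rpow_one]
        gcongr
        linarith
    _ = (2 * (G.h1NormSq f).toReal) ^ (p / 2) := by
        rw [← Real.rpow_add_of_nonneg (by positivity) (by linarith) zero_le_one]
        ring_nf

theorem MemH1.massOn_ne_top [Countable G.Edge] (hconn : IsConnected G.carrier)
    (hunb : G.IsUnbounded) {p : ℝ} (hp : 2 < p) (hf : G.MemH1 f) :
    G.massOn p f univ ≠ ⊤ := ((hf.massOn_le hconn hunb hp).trans_lt ENNReal.ofReal_lt_top).ne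

/-- The Sobolev bound m ≤ (2E)^(p/2) says m^(2/p) ≤ 2E. Only positivity is needed later, to divide
by the infimum. -/
theorem half_le_infQuotient [Countable G.Edge] (hconn : IsConnected G.carrier)
    (hunb : G.IsUnbounded) {p : ℝ} (hp : 2 < p) : 1 / 2 ≤ G.infQuotient 𝕜 p := by
  refine le_sInf ?_
  rintro _ ⟨f, hf, ⟨x, hx, hfx⟩, rfl⟩
  have hm := hf.1.massOn_le hconn hunb hp
  have hE := hf.1.h1NormSq_lt_top.ne
  have h1 := hf.1.norm_sq_le hconn hunb hx
  have hpos : 0 < ‖f x‖ ^ 2 := by positivity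
  have hE0 : 0 < (G.h1NormSq f).toReal := by linarith
  have hle : G.massOn p f univ ^ (2 / p) ≤ 2 * G.h1NormSq f := by
    calc G.massOn p f univ ^ (2 / p)
        ≤ ENNReal.ofReal ((2 * (G.h1NormSq f).toReal) ^ (p / 2)) ^ (2 / p) := by
          gcongr
      _ = 2 * G.h1NormSq f := by
          rw [ENNReal.ofReal_rpow_of_nonneg (by positivity) (by positivity),
            ← Real.rpow_mul (by positivity), show p / 2 * (2 / p) = 1 by field_simp,
            Real.rpow_one, ENNReal.ofReal_mul (by norm_num), ENNReal.ofReal_toReal hE]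
          simp
  have hE0' : G.h1NormSq f ≠ 0 := fun h => by simp [h] at hE0
  rw [quotient]
  calc (1 : ℝ≥0∞) / 2 = G.h1NormSq f / (2 * G.h1NormSq f) := by
        rw [ENNReal.div_eq_inv_mul, ENNReal.div_eq_inv_mul,
          ENNReal.mul_inv (by simp) (by simp), mul_assoc, ENNReal.inv_mul_cancel hE0' hE]
    _ ≤ _ := ENNReal.div_le_div_left hle _

/-- Functions that vanish on the graph are not competitors but have mass 0. They must be covered,
since a piece produced by a cut-off may vanish. -/
theorem MemH10.infQuotient_mul_le [Countable G.Edge] {p : ℝ} (hp : 2 < p) (hf : G.MemH10 f) :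
    G.infQuotient 𝕜 p * G.massOn p f univ ^ (2 / p) ≤ G.h1NormSq f := by
  by_cases h : ∃ x ∈ G.carrier, f x ≠ 0
  · refine ENNReal.mul_le_of_le_div ?_
    exact sInf_le ⟨f, hf, h, rfl⟩
  · push Not at h
    have : G.massOn p f univ = 0 := by
      refine le_antisymm ((massOn_le_of_norm_sq_le hp (S := 0) fun x hx => by simp [h x hx]).trans
        ?_) bot_le
      rw [Real.zero_rpow (by linarith)]
      simp
    rw [this, ENNReal.zero_rpow_of_pos (by positivity)]
    simp

theorem MemH10.toReal_massOn_le [Countable G.Edge] (hconn : IsConnected G.carrier)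
    (hunb : G.IsUnbounded) {p : ℝ} (hp : 2 < p) (hI : G.infQuotient 𝕜 p ≠ ⊤) (hf : G.MemH10 f) :
    (G.massOn p f univ).toReal ≤
      ((G.h1NormSq f).toReal / (G.infQuotient 𝕜 p).toReal) ^ (p / 2) := by
  have h0 : G.infQuotient 𝕜 p ≠ 0 :=
    (lt_of_lt_of_le (by simp) (half_le_infQuotient (𝕜 := 𝕜) hconn hunb hp)).ne'
  have hI0 := ENNReal.toReal_pos h0 hI
  have h := ENNReal.toReal_mono hf.1.h1NormSq_lt_top.ne (hf.infQuotient_mul_le hp)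
  rw [ENNReal.toReal_mul, ← ENNReal.toReal_rpow, ← le_div_iff₀' hI0] at h
  calc (G.massOn p f univ).toReal = ((G.massOn p f univ).toReal ^ (2 / p)) ^ (p / 2) := by
        rw [← Real.rpow_mul ENNReal.toReal_nonneg, show 2 / p * (p / 2) = 1 by field_simp,
          Real.rpow_one]
    _ ≤ _ := by gcongr

end EmbeddedGraph

/-! ### A scalar inequality against splitting -/

/-- Strict convexity of `t ↦ t ^ r`, `r > 1`, excludes a splitting into two parts of positive
energy. -/
theorem exists_forall_le_of_add_le_of_le_rpow {r I c ε : ℝ} (hr : 1 < r) (hI : 0 < I) (hc : 0 < c)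
    (hε : 0 < ε) : ∃ η > 0, ∀ E₁ E₂ m₁ m₂ : ℝ, c ≤ E₁ → 0 ≤ E₂ → E₁ + E₂ ≤ I + η →
      1 - η ≤ m₁ + m₂ → m₁ ≤ (E₁ / I) ^ r → m₂ ≤ (E₂ / I) ^ r → E₂ ≤ ε := by
  -- If E₂ > ε, both normalised energies are at least 2κ. Their sum is at most 1 + η/I ≤ 1 + κ, so
  -- both are at most 1 - κ.
  obtain ⟨κ, hκ0, hκ1, hκc, hκε⟩ :
      ∃ κ : ℝ, 0 < κ ∧ κ < 1 ∧ 2 * κ ≤ c / I ∧ 2 * κ ≤ ε / I := by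
    have h1 : 0 < c / I := by positivity
    have h2 : 0 < ε / I := by positivity
    refine ⟨min (1 / 2) (min (c / I) (ε / I) / 2), by positivity, ?_, ?_, ?_⟩
    · exact (min_le_left _ _).trans_lt (by norm_num)
    · linarith [min_le_right (1 / 2) (min (c / I) (ε / I) / 2), min_le_left (c / I) (ε / I)]
    · linarith [min_le_right (1 / 2) (min (c / I) (ε / I) / 2), min_le_right (c / I) (ε / I)]
  set θ : ℝ := (1 - κ) ^ (r - 1) with hθ
  have hθ1 : θ < 1 := Real.rpow_lt_one (by linarith) (by linarith) (by linarith)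
  have hθ0 : 0 ≤ θ := Real.rpow_nonneg (by linarith) _
  -- Away from 1, raising to the power r costs at least the fixed factor θ < 1 compared with the
  -- identity.
  have key : ∀ t, 0 ≤ t → t ≤ 1 - κ → t ^ r ≤ t * θ := fun t h0 h1 => by
    have : t ^ r = t * t ^ (r - 1) := by
      rw [mul_comm, ← Real.rpow_add_one' h0 (by linarith)]
      congr 1; ring
    rw [this]
    exact mul_le_mul_of_nonneg_left (Real.rpow_le_rpow h0 h1 (by linarith)) h0
  -- The total mass would satisfy 1 - η ≤ (1 + η/I)θ ≤ θ + η/I, that is 1 - θ ≤ η(1 + 1/I); the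
  -- extra 2 in the denominator makes this contradictory.
  refine ⟨min (κ * I) ((1 - θ) / (2 * (1 + 1 / I))), ?_, ?_⟩
  · have : 0 < 1 - θ := by linarith
    positivity
  intro E₁ E₂ m₁ m₂ h1 h2 hE hm hm1 hm2
  set η := min (κ * I) ((1 - θ) / (2 * (1 + 1 / I)))
  have hη1 : η ≤ κ * I := min_le_left _ _
  have hη2 : η * (1 + 1 / I) < 1 - θ := by
    have : η ≤ (1 - θ) / (2 * (1 + 1 / I)) := min_le_right _ _
    rw [le_div_iff₀ (by positivity)] at this
    nlinarith
  have hη0 : 0 < η := by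
    have : 0 < 1 - θ := by linarith
    positivity
  by_contra! hlt
  have e1 : 2 * κ ≤ E₁ / I := hκc.trans (by gcongr)
  have e2 : 2 * κ ≤ E₂ / I := hκε.trans (by gcongr)
  have es : E₁ / I + E₂ / I ≤ 1 + η / I := by
    rw [← add_div, ← div_self hI.ne', ← add_div]
    gcongr
  have hηI : η / I ≤ κ := by rw [div_le_iff₀ hI]; exact hη1
  have k1 := key (E₁ / I) (by linarith) (by linarith)
  have k2 := key (E₂ / I) (by linarith) (by linarith)
  have k3 : (E₁ / I + E₂ / I) * θ ≤ (1 + η / I) * θ := by gcongr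
  have k4 : η / I * θ ≤ η / I * 1 := by gcongr
  have k5 : η * (1 + 1 / I) = η + η / I := by ring
  linarith

/-! ### Non-vanishing and splitting of almost minimisers -/

namespace EmbeddedGraph

variable {d : ℕ} {G : EmbeddedGraph d} {𝕜 : Type*} [RCLike 𝕜]
  {f g : EuclideanSpace ℝ (Fin d) → 𝕜}

/-- Functions that do not vanish in `L^p` carry a definite amount of energy in some unit ball. -/
theorem exists_forall_ofReal_le_energyOn_ball [Countable G.Edge] (hconn : IsConnected G.carrier)
    (hunb : G.IsUnbounded) {p : ℝ} (hp : 2 < p) {K : ℝ} (hK : 0 < K) :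
    ∃ c : ℝ, 0 < c ∧ ∀ f : EuclideanSpace ℝ (Fin d) → 𝕜, G.MemH1 f → G.massOn p f univ = 1 →
      (G.h1NormSq f).toReal ≤ K →
        ∃ x ∈ G.carrier, ENNReal.ofReal c ≤ G.energyOn f (Metric.ball x 1) := by
  -- Chosen so that S^(p/2 - 1) = 1/(2K): if |f|² ≤ S everywhere, the mass would be at most 1/2.
  set S : ℝ := (1 / (2 * K)) ^ (p / 2 - 1)⁻¹ with hS
  have hS0 : 0 < S := by positivity
  refine ⟨S / 2, by positivity, fun f hf hm hE => ?_⟩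
  obtain ⟨x, hx, hxS⟩ : ∃ x ∈ G.carrier, S < ‖f x‖ ^ 2 := by
    by_contra! h
    have h1 := massOn_le_of_norm_sq_le hp h
    rw [hm, hS, ← Real.rpow_mul (by positivity), inv_mul_cancel₀ (by linarith), Real.rpow_one,
      ← ENNReal.ofReal_toReal hf.h1NormSq_lt_top.ne, ← ENNReal.ofReal_mul (by positivity),
      ENNReal.one_le_ofReal] at h1
    have h2 : 1 / (2 * K) * (G.h1NormSq f).toReal ≤ 1 / (2 * K) * K := by gcongr
    have h3 : 1 / (2 * K) * K = 1 / 2 := by field_simp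
    linarith
  refine ⟨x, hx, ?_⟩
  have h1 := hf.ofReal_norm_sq_le_energyOn_ball hconn hunb hx
  have h2 : 2 * ENNReal.ofReal (S / 2) ≤ 2 * G.energyOn f (Metric.ball x 1) := by
    refine le_trans ?_ h1
    rw [show (2 : ℝ≥0∞) = ENNReal.ofReal 2 by simp, ← ENNReal.ofReal_mul (by norm_num)]
    exact ENNReal.ofReal_le_ofReal (by linarith)
  exact (ENNReal.mul_le_mul_iff_right (by simp) (by simp)).1 h2

/-! ### Splitting of a function along an annulus -/

/-- The cut-off function that is `1` on the ball of radius `ρ` around `x` and `0` outside the ball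
of radius `ρ + L`. -/
noncomputable def cutoff (x : EuclideanSpace ℝ (Fin d)) (ρ L : ℝ)
    (y : EuclideanSpace ℝ (Fin d)) : ℝ := max (min (1 + (ρ - dist y x) / L) 1) 0

theorem lipschitzWith_cutoff (x : EuclideanSpace ℝ (Fin d)) (ρ : ℝ) {L : ℝ} (hL : 0 < L) :
    LipschitzWith (Real.toNNReal L⁻¹) (cutoff x ρ L) := by
  have h : LipschitzWith (Real.toNNReal L⁻¹)
      fun y : EuclideanSpace ℝ (Fin d) => 1 + (ρ - dist y x) / L :=
    LipschitzWith.of_dist_le_mul fun y z => by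
      rw [Real.dist_eq, Real.coe_toNNReal _ (by positivity),
        show 1 + (ρ - dist y x) / L - (1 + (ρ - dist z x) / L) =
          L⁻¹ * (dist z x - dist y x) by field_simp; ring, abs_mul, abs_of_pos (by positivity),
        dist_comm y z]
      gcongr
      exact abs_dist_sub_le _ _ _
  exact (h.min_const 1).max_const 0

theorem cutoff_nonneg (x y : EuclideanSpace ℝ (Fin d)) (ρ L : ℝ) : 0 ≤ cutoff x ρ L y :=
  le_max_right _ _

theorem cutoff_le_one (x y : EuclideanSpace ℝ (Fin d)) (ρ L : ℝ) : cutoff x ρ L y ≤ 1 :=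
  max_le (min_le_right _ _) zero_le_one

theorem cutoff_eq_one {x y : EuclideanSpace ℝ (Fin d)} {ρ L : ℝ} (hL : 0 < L)
    (h : dist y x ≤ ρ) : cutoff x ρ L y = 1 := by
  have : 0 ≤ (ρ - dist y x) / L := div_nonneg (by linarith) hL.le
  rw [cutoff, min_eq_right (by linarith), max_eq_left zero_le_one]

theorem cutoff_eq_zero {x y : EuclideanSpace ℝ (Fin d)} {ρ L : ℝ} (hL : 0 < L)
    (h : ρ + L ≤ dist y x) : cutoff x ρ L y = 0 := by
  have : (ρ - dist y x) / L ≤ -1 := by rw [div_le_iff₀ hL]; linarith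
  exact max_eq_right ((min_le_left _ _).trans (by linarith))

theorem lipschitzWith_one_sub {ψ : EuclideanSpace ℝ (Fin d) → ℝ} {K : NNReal}
    (hψ : LipschitzWith K ψ) : LipschitzWith K fun y => 1 - ψ y :=
  LipschitzWith.of_dist_le_mul fun y z => by
    have := hψ.dist_le_mul y z
    rwa [dist_sub_left]

/-- Since ψ² + (1 - ψ)² ≤ 1, only the Lipschitz constant costs energy: 2K² ≤ 2K from the gradient
terms and K from the cross terms. -/
theorem MemH10.h1NormSq_cutoff_add_le [Countable G.Edge] (hf : G.MemH10 f)
    {ψ : EuclideanSpace ℝ (Fin d) → ℝ} {K : NNReal} (hψ : LipschitzWith K ψ) (hK : K ≤ 1)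
    (h0 : ∀ y, 0 ≤ ψ y) (h1 : ∀ y, ψ y ≤ 1) :
    G.h1NormSq (fun y => ψ y • f y) + G.h1NormSq (fun y => (1 - ψ y) • f y) ≤
      ENNReal.ofReal (1 + 3 * K) * G.h1NormSq f := by
  simp only [h1NormSq_eq]
  rw [← lintegral_const_mul' _ _ ENNReal.ofReal_ne_top,
    ← lintegral_add_left' (aemeasurable_dens (hf.cutoff hψ h0 h1).1.continuousOn)]
  refine lintegral_mono_ae ?_
  filter_upwards [hf.1.ae_dens_cutoff_le hψ h0, hf.1.ae_dens_cutoff_le (lipschitzWith_one_sub hψ)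
    fun y => by linarith [h1 y]] with x hx hx'
  rw [← ENNReal.ofReal_mul (by positivity),
    ← ENNReal.ofReal_add (G.dens_nonneg _ _) (G.dens_nonneg _ _)]
  refine ENNReal.ofReal_le_ofReal ?_
  have hD := G.dens_nonneg f x
  have hfD : ‖f (G.pt x)‖ ^ 2 ≤ G.dens f x := le_add_of_nonneg_left (by positivity)
  have hK0 : (0 : ℝ) ≤ K := K.2
  have hK1 : (K : ℝ) ≤ 1 := by exact_mod_cast hK
  have a1 : (K : ℝ) ^ 2 * ‖f (G.pt x)‖ ^ 2 ≤ K * G.dens f x := by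
    gcongr
    nlinarith
  have a2 : (ψ (G.pt x) ^ 2 + (1 - ψ (G.pt x)) ^ 2) * G.dens f x ≤ 1 * G.dens f x := by
    gcongr
    nlinarith [h0 (G.pt x), h1 (G.pt x), mul_nonneg (h0 (G.pt x)) (sub_nonneg.2 (h1 (G.pt x)))]
  linarith

/-- Off the transition region one piece is f and the other is 0, so mass can only be lost inside
`A`. -/
theorem MemH10.massOn_le_cutoff_add [Countable G.Edge] (hf : G.MemH10 f) {p : ℝ} (hp : 0 < p)
    {ψ : EuclideanSpace ℝ (Fin d) → ℝ} {K : NNReal} (hψ : LipschitzWith K ψ)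
    (h0 : ∀ y, 0 ≤ ψ y) (h1 : ∀ y, ψ y ≤ 1) {A : Set (EuclideanSpace ℝ (Fin d))}
    (hA : MeasurableSet A) (hA' : ∀ y ∉ A, ψ y = 0 ∨ ψ y = 1) :
    G.massOn p f univ ≤ G.massOn p (fun y => ψ y • f y) univ +
      G.massOn p (fun y => (1 - ψ y) • f y) univ + G.massOn p f A := by
  rw [massOn_eq hp.le f hA]
  simp only [massOn_univ_eq hp.le]
  rw [← lintegral_add_left' (aemeasurable_norm_rpow (hf.cutoff hψ h0 h1).1.continuousOn p),
    ← lintegral_add_compl _ (measurable_pt hA), add_comm]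
  refine add_le_add ?_ le_rfl
  refine le_trans (setLIntegral_mono' (measurable_pt hA).compl fun x hx => ?_)
    (setLIntegral_le_lintegral _ _)
  rcases hA' _ hx with h | h <;> simp [h, Real.zero_rpow hp.ne']

theorem massOn_congr [Countable G.Edge] {p : ℝ} (hp : 0 ≤ p)
    {A : Set (EuclideanSpace ℝ (Fin d))} (hA : MeasurableSet A) (h : EqOn f g A) :
    G.massOn p f A = G.massOn p g A := by
  rw [massOn_eq hp f hA, massOn_eq hp g hA]
  exact setLIntegral_congr_fun (measurable_pt hA) fun x hx => by rw [h hx]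

/-- Equality on an open neighbourhood of `A` is required because the energy involves derivatives. -/
theorem energyOn_congr [Countable G.Edge] {U A : Set (EuclideanSpace ℝ (Fin d))} (hU : IsOpen U)
    (hA : MeasurableSet A) (hAU : A ⊆ U) (h : EqOn f g U) : G.energyOn f A = G.energyOn g A := by
  rw [energyOn_eq f hA, energyOn_eq g hA]
  refine setLIntegral_congr_fun (measurable_pt hA) fun x hx => ?_
  have hs : G.slope f x = G.slope g x := by
    refine Filter.EventuallyEq.deriv_eq ?_
    filter_upwards [(isometry_point x.1).continuous.continuousAt.preimage_mem_nhds
      (hU.mem_nhds (hAU hx))] with t ht using h ht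
  simp only [dens, hs, h (hAU hx)]

theorem massOn_mono {p : ℝ} (f : EuclideanSpace ℝ (Fin d) → 𝕜)
    {A B : Set (EuclideanSpace ℝ (Fin d))} (h : A ⊆ B) : G.massOn p f A ≤ G.massOn p f B :=
  ENNReal.tsum_le_tsum fun _ =>
    lintegral_mono_set (inter_subset_inter_right _ (preimage_mono h))

/-- Among `N` consecutive annuli there is one with little mass. -/
theorem exists_massOn_annulus_le [Countable G.Edge] {p : ℝ} (hp : 0 ≤ p)
    (hm : G.massOn p f univ = 1) (x : EuclideanSpace ℝ (Fin d)) {L η : ℝ} (hL : 0 < L)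
    {N : ℕ} (hN : 1 < N * η) :
    ∃ j < N, G.massOn p f {y | 1 + j * L ≤ dist y x ∧ dist y x < 1 + j * L + L} ≤
      ENNReal.ofReal η := by
  -- The annuli are half-open, hence disjoint, and start at radius 1, so that a cut-off along any of
  -- them equals 1 on the unit ball.
  set A : ℕ → Set (EuclideanSpace ℝ (Fin d)) :=
    fun j => {y | 1 + j * L ≤ dist y x ∧ dist y x < 1 + j * L + L} with hA
  have hAm : ∀ j, MeasurableSet (A j) := fun j =>
    (measurableSet_le measurable_const (measurable_id.dist measurable_const)).inter
      (measurableSet_lt (measurable_id.dist measurable_const) measurable_const)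
  have hdisj : Pairwise (Function.onFun Disjoint A) := by
    have haux : ∀ i j : ℕ, i < j → Disjoint (A i) (A j) := fun i j hij => by
      rw [Set.disjoint_left]
      rintro y ⟨_, h1⟩ ⟨h2, _⟩
      have : (i : ℝ) + 1 ≤ j := by exact_mod_cast hij
      nlinarith
    intro i j hij
    rcases hij.lt_or_gt with h | h
    · exact haux i j h
    · exact (haux j i h).symm
  by_contra! h
  have hsum : ∑ j ∈ Finset.range N, G.massOn p f (A j) ≤ 1 := by
    rw [← hm, massOn_univ_eq hp]
    simp only [massOn_eq hp f (hAm _)]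
    rw [← lintegral_biUnion_finset (fun i _ j _ hij => (hdisj hij).preimage G.pt)
      fun j _ => measurable_pt (hAm j)]
    exact setLIntegral_le_lintegral _ _
  have hcard := Finset.card_nsmul_le_sum (Finset.range N) (fun j => G.massOn p f (A j))
    (ENNReal.ofReal η) fun j hj => (h j (Finset.mem_range.1 hj)).le
  rw [Finset.card_range, ← ENNReal.ofReal_nsmul, nsmul_eq_mul] at hcard
  have := hcard.trans hsum
  rw [ENNReal.ofReal_le_one] at this
  linarith

/-- Almost minimisers with some energy in the unit ball around `x` have almost all of their energy
in a ball around `x` whose radius does not depend on the function. -/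
theorem exists_forall_energyOn_compl_ball_le [Countable G.Edge] (hconn : IsConnected G.carrier)
    (hunb : G.IsUnbounded) {p : ℝ} (hp : 2 < p) (hI : G.infQuotient 𝕜 p ≠ ⊤) {c ε : ℝ}
    (hc : 0 < c) (hε : 0 < ε) :
    ∃ R δ : ℝ, 0 < R ∧ 0 < δ ∧ ∀ (f : EuclideanSpace ℝ (Fin d) → 𝕜)
      (x : EuclideanSpace ℝ (Fin d)), G.MemH10 f → G.massOn p f univ = 1 →
      (G.h1NormSq f).toReal ≤ (G.infQuotient 𝕜 p).toReal + δ →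
      ENNReal.ofReal c ≤ G.energyOn f (Metric.ball x 1) →
        G.energyOn f (Metric.ball x R)ᶜ ≤ ENNReal.ofReal ε ∧
        G.massOn p f (Metric.ball x R)ᶜ ≤ ENNReal.ofReal ((2 * ε) ^ (p / 2)) := by
  have hI0 : 0 < (G.infQuotient 𝕜 p).toReal := ENNReal.toReal_pos
    (lt_of_lt_of_le (by simp) (half_le_infQuotient (𝕜 := 𝕜) hconn hunb hp)).ne' hI
  set I : ℝ := (G.infQuotient 𝕜 p).toReal with hIdef
  obtain ⟨η, hη, H⟩ := exists_forall_le_of_add_le_of_le_rpow (r := p / 2) (by linarith) hI0 hc hε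
  -- The excess energy δ and the cutting cost 3/L are both made small by taking δ = 1/L with L
  -- large.
  obtain ⟨δ, L, hδ, hL, hLδ⟩ : ∃ δ L : ℝ, 0 < δ ∧ 1 ≤ L ∧ (1 + 3 * L⁻¹) * (I + δ) ≤ I + η := by
    have hlim : Tendsto (fun L : ℝ => (1 + 3 * L⁻¹) * (I + L⁻¹)) atTop
        (𝓝 ((1 + 3 * 0) * (I + 0))) :=
      (tendsto_const_nhds.add (tendsto_inv_atTop_zero.const_mul 3)).mul
        (tendsto_const_nhds.add tendsto_inv_atTop_zero)
    obtain ⟨L, h1, h2⟩ := ((hlim.eventually_lt_const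
      (show (1 + 3 * 0) * (I + 0) < I + η by linarith)).and (eventually_ge_atTop 1)).exists
    exact ⟨L⁻¹, L, by positivity, h2, h1.le⟩
  have hL0 : 0 < L := by linarith
  obtain ⟨N, hN⟩ := exists_nat_gt (1 / η)
  rw [div_lt_iff₀ hη] at hN
  -- Every annulus ends at radius at most 1 + NL; the additional 1 puts the closed ball of that
  -- radius inside an open one.
  refine ⟨2 + N * L, δ, by positivity, hδ, fun f x hf hm hE hcE => ?_⟩
  obtain ⟨j, hj, hjm⟩ := exists_massOn_annulus_le (by linarith) hm x hL0 hN
  set ρ : ℝ := 1 + j * L with hρ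
  have hjL : (j : ℝ) * L + L ≤ N * L := by
    have : (j : ℝ) + 1 ≤ N := by exact_mod_cast hj
    nlinarith
  have hρ1 : 1 ≤ ρ := le_add_of_nonneg_right (by positivity)
  set ψ := cutoff x ρ L with hψ
  have hψL := lipschitzWith_cutoff x ρ hL0
  have h0 : ∀ y, 0 ≤ ψ y := fun y => cutoff_nonneg x y ρ L
  have h1 : ∀ y, ψ y ≤ 1 := fun y => cutoff_le_one x y ρ L
  have hf1 := hf.cutoff hψL h0 h1
  have hf2 := hf.cutoff (lipschitzWith_one_sub hψL) (fun y => by linarith [h1 y])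
    fun y => by linarith [h0 y]
  have hK : Real.toNNReal L⁻¹ ≤ 1 := by
    rw [Real.toNNReal_le_one]
    exact inv_le_one_of_one_le₀ hL
  have hEsum := hf.h1NormSq_cutoff_add_le hψL hK h0 h1
  have hmsum := hf.massOn_le_cutoff_add (p := p) (by linarith) hψL h0 h1
    (A := {y | ρ ≤ dist y x ∧ dist y x < ρ + L})
    ((measurableSet_le measurable_const (measurable_id.dist measurable_const)).inter
      (measurableSet_lt (measurable_id.dist measurable_const) measurable_const))
    fun y hy => by
      by_cases hy1 : dist y x ≤ ρ
      · exact Or.inr (cutoff_eq_one hL0 hy1)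
      · refine Or.inl (cutoff_eq_zero hL0 ?_)
        by_contra! hlt
        exact hy ⟨(not_le.1 hy1).le, hlt⟩
  -- The inner piece coincides with f on the unit ball and so inherits its energy.
  have hE1 : c ≤ (G.h1NormSq fun y => ψ y • f y).toReal := by
    rw [← ENNReal.ofReal_le_iff_le_toReal hf1.1.h1NormSq_lt_top.ne]
    refine hcE.trans ?_
    rw [energyOn_congr Metric.isOpen_ball measurableSet_ball Subset.rfl
      (g := fun y => ψ y • f y) fun y hy => ?_]
    · exact energyOn_mono _ (subset_univ _)
    · simp only [hψ]
      rw [cutoff_eq_one hL0 ((Metric.mem_ball.1 hy).le.trans hρ1), one_smul]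
  have hEs : (G.h1NormSq fun y => ψ y • f y).toReal +
      (G.h1NormSq fun y => (1 - ψ y) • f y).toReal ≤ I + η := by
    rw [← ENNReal.toReal_add hf1.1.h1NormSq_lt_top.ne hf2.1.h1NormSq_lt_top.ne]
    refine (ENNReal.toReal_mono (ENNReal.mul_ne_top ENNReal.ofReal_ne_top
      hf.1.h1NormSq_lt_top.ne) hEsum).trans ?_
    rw [ENNReal.toReal_mul, ENNReal.toReal_ofReal (by positivity),
      Real.coe_toNNReal _ (by positivity)]
    refine le_trans ?_ hLδ
    gcongr
  have hms : 1 - η ≤ (G.massOn p (fun y => ψ y • f y) univ).toReal +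
      (G.massOn p (fun y => (1 - ψ y) • f y) univ).toReal := by
    have t1 := hf1.1.massOn_ne_top hconn hunb hp
    have t2 := hf2.1.massOn_ne_top hconn hunb hp
    rw [hm] at hmsum
    have := ENNReal.toReal_mono (ENNReal.add_ne_top.2 ⟨ENNReal.add_ne_top.2 ⟨t1, t2⟩,
      ENNReal.ofReal_ne_top⟩) (hmsum.trans (add_le_add_right hjm _))
    rw [ENNReal.toReal_add (ENNReal.add_ne_top.2 ⟨t1, t2⟩) ENNReal.ofReal_ne_top,
      ENNReal.toReal_add t1 t2, ENNReal.toReal_ofReal hη.le, ENNReal.toReal_one] at this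
    linarith
  have hE2 := H _ _ _ _ hE1 ENNReal.toReal_nonneg hEs hms
    (hf1.toReal_massOn_le hconn hunb hp hI) (hf2.toReal_massOn_le hconn hunb hp hI)
  have hfar : EqOn f (fun y => (1 - ψ y) • f y) (Metric.closedBall x (ρ + L))ᶜ := fun y hy => by
    have hy' : ρ + L ≤ dist y x := by
      simp only [mem_compl_iff, Metric.mem_closedBall, not_le] at hy
      exact hy.le
    simp only [hψ]
    rw [cutoff_eq_zero hL0 hy', sub_zero, one_smul]
  have hsub : (Metric.ball x (2 + N * L))ᶜ ⊆ (Metric.closedBall x (ρ + L))ᶜ :=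
    compl_subset_compl.2 (Metric.closedBall_subset_ball (by rw [hρ]; linarith))
  constructor
  · rw [energyOn_congr Metric.isClosed_closedBall.isOpen_compl measurableSet_ball.compl hsub hfar]
    refine (energyOn_mono _ (subset_univ _)).trans ?_
    exact (ENNReal.le_ofReal_iff_toReal_le hf2.1.h1NormSq_lt_top.ne hε.le).2 hE2
  · rw [massOn_congr (by linarith) measurableSet_ball.compl (hfar.mono hsub)]
    refine (massOn_mono _ (subset_univ _)).trans ((hf2.1.massOn_le hconn hunb hp).trans ?_)
    refine ENNReal.ofReal_le_ofReal ?_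
    gcongr

end EmbeddedGraph

namespace EmbeddedGraph

variable {d : ℕ} {G : EmbeddedGraph d} {𝕜 : Type*} [RCLike 𝕜]
  {f g : EuclideanSpace ℝ (Fin d) → 𝕜}

/-! ### Completeness of `H¹₀(G)` -/

theorem eLpNorm_two_sq {α : Type*} [MeasurableSpace α] {μ : Measure α} (F : α → 𝕜) :
    eLpNorm F 2 μ ^ 2 = ∫⁻ x, ‖F x‖ₑ ^ 2 ∂μ := by
  have := eLpNorm_nnreal_pow_eq_lintegral (f := F) (μ := μ) (p := 2) (by norm_num)
  simpa using this

theorem h1NormSq_eq_eLpNorm [Countable G.Edge] (f : EuclideanSpace ℝ (Fin d) → 𝕜) :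
    G.h1NormSq f = eLpNorm (G.slope f) 2 G.edgeMeasure ^ 2 +
      eLpNorm (fun x => f (G.pt x)) 2 G.edgeMeasure ^ 2 := by
  rw [h1NormSq_eq, eLpNorm_two_sq, eLpNorm_two_sq,
    ← lintegral_add_left' ((aestronglyMeasurable_slope f).enorm.pow_const 2)]
  simp_rw [ofReal_dens]

theorem MemH1.memLp_slope [Countable G.Edge] (hf : G.MemH1 f) :
    MemLp (G.slope f) 2 G.edgeMeasure := by
  refine ⟨aestronglyMeasurable_slope f, ?_⟩
  have h := hf.h1NormSq_lt_top
  rw [h1NormSq_eq_eLpNorm] at h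
  exact (ENNReal.pow_lt_top_iff.1 (ENNReal.add_lt_top.1 h).1).resolve_right (by norm_num)

theorem MemH1.memLp_comp_pt [Countable G.Edge] (hf : G.MemH1 f) :
    MemLp (fun x => f (G.pt x)) 2 G.edgeMeasure := by
  refine ⟨aestronglyMeasurable_comp_pt hf.continuousOn, ?_⟩
  have h := hf.h1NormSq_lt_top
  rw [h1NormSq_eq_eLpNorm] at h
  exact (ENNReal.pow_lt_top_iff.1 (ENNReal.add_lt_top.1 h).2).resolve_right (by norm_num)

theorem MemH1.eLpNorm_slope_sub [Countable G.Edge] (hf : G.MemH1 f) (hg : G.MemH1 g) :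
    eLpNorm (G.slope (f - g)) 2 G.edgeMeasure =
      eLpNorm (G.slope f - G.slope g) 2 G.edgeMeasure :=
  eLpNorm_congr_ae (hf.ae_slope_sub hg)

/-- The restriction of a square-integrable function to a bounded part of an edge. -/
theorem eLpNorm_one_edge_le (F : G.Edge × ℝ → 𝕜)
    (hF : AEStronglyMeasurable F G.edgeMeasure) {e : G.Edge} {a b : ℝ} (ha : a ∈ G.closedParam e)
    (hb : b ∈ G.closedParam e) :
    eLpNorm (fun t => F (e, t)) 1 (volume.restrict (Ioo a b)) ≤
      eLpNorm F 2 G.edgeMeasure * volume (Ioo a b) ^ (1 / 2 : ℝ) := by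
  have hle : (volume.restrict (G.openParam e)).map (Prod.mk e) ≤ G.edgeMeasure :=
    Measure.le_sum (fun e => (volume.restrict (G.openParam e)).map (Prod.mk e)) e
  have hm : AEStronglyMeasurable (fun t => F (e, t)) (volume.restrict (Ioo a b)) :=
    ((measurableEmbedding_mk e).aestronglyMeasurable_map_iff.1 (hF.mono_measure hle)).mono_measure
      (Measure.restrict_mono_set _ (Ioo_subset_openParam ha hb))
  have h1 := eLpNorm_le_eLpNorm_mul_rpow_measure_univ (p := 1) (q := 2) (by norm_num) hm
  have h2 : eLpNorm (fun t => F (e, t)) 2 (volume.restrict (Ioo a b)) ≤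
      eLpNorm F 2 G.edgeMeasure :=
    ((eLpNorm_mono_measure _
      (Measure.restrict_mono_set _ (Ioo_subset_openParam ha hb))).trans_eq
      (measurableEmbedding_mk e).eLpNorm_map_measure.symm).trans (eLpNorm_mono_measure F hle)
  refine h1.trans ?_
  rw [Measure.restrict_apply_univ]
  norm_num
  gcongr

theorem integrableOn_edge {F : G.Edge × ℝ → 𝕜} (hF : MemLp F 2 G.edgeMeasure) {e : G.Edge}
    {a b : ℝ} (ha : a ∈ G.closedParam e) (hb : b ∈ G.closedParam e) :
    IntegrableOn (fun t => F (e, t)) (Ioo a b) := by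
  have hle : (volume.restrict (G.openParam e)).map (Prod.mk e) ≤ G.edgeMeasure :=
    Measure.le_sum (fun e => (volume.restrict (G.openParam e)).map (Prod.mk e)) e
  rw [IntegrableOn, ← memLp_one_iff_integrable]
  refine ⟨((measurableEmbedding_mk e).aestronglyMeasurable_map_iff.1
    (hF.1.mono_measure hle)).mono_measure
      (Measure.restrict_mono_set _ (Ioo_subset_openParam ha hb)), ?_⟩
  refine (eLpNorm_one_edge_le F hF.1 ha hb).trans_lt (ENNReal.mul_lt_top hF.2 ?_)
  exact ENNReal.rpow_lt_top_of_nonneg (by norm_num) (by simp)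

theorem intervalIntegrable_edge {F : G.Edge × ℝ → 𝕜} (hF : MemLp F 2 G.edgeMeasure) {e : G.Edge}
    {a b : ℝ} (ha : a ∈ G.closedParam e) (hb : b ∈ G.closedParam e) :
    IntervalIntegrable (fun t => F (e, t)) volume a b := by
  rcases le_total a b with h | h
  · exact (intervalIntegrable_iff_integrableOn_Ioo_of_le h).2 (integrableOn_edge hF ha hb)
  · exact ((intervalIntegrable_iff_integrableOn_Ioo_of_le h).2 (integrableOn_edge hF hb ha)).symm

theorem MemH1.sub_eq_integral_slope [Countable G.Edge] (hf : G.MemH1 f) {e : G.Edge}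
    {a b : ℝ} (ha : a ∈ G.closedParam e) (hb : b ∈ G.closedParam e) :
    f (G.point e b) - f (G.point e a) = ∫ t in a..b, G.slope f (e, t) :=
  ((hf.absolutelyContinuous e a ha b hb).integral_deriv_eq_sub_of_finiteDimensional
    (intervalIntegrable_edge hf.memLp_slope ha hb)).symm

/-- By Hölder, L² convergence on the graph gives L¹ convergence on bounded parts of an edge. -/
theorem tendsto_integral_edge {F : ℕ → G.Edge × ℝ → 𝕜} {F' : G.Edge × ℝ → 𝕜}
    (hF : ∀ n, MemLp (F n) 2 G.edgeMeasure) (hF' : MemLp F' 2 G.edgeMeasure)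
    (hlim : Tendsto (fun n => eLpNorm (F n - F') 2 G.edgeMeasure) atTop (𝓝 0)) {e : G.Edge}
    {a b : ℝ} (ha : a ∈ G.closedParam e) (hb : b ∈ G.closedParam e) :
    Tendsto (fun n => ∫ t in a..b, F n (e, t)) atTop (𝓝 (∫ t in a..b, F' (e, t))) := by
  have key : ∀ {a b : ℝ}, a ∈ G.closedParam e → b ∈ G.closedParam e → a ≤ b →
      Tendsto (fun n => ∫ t in a..b, F n (e, t)) atTop (𝓝 (∫ t in a..b, F' (e, t))) := by
    intro a b ha hb hab
    simp only [intervalIntegral.integral_of_le hab, integral_Ioc_eq_integral_Ioo]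
    refine tendsto_integral_of_L1' _ (integrableOn_edge hF' ha hb).1
      (Eventually.of_forall fun n => integrableOn_edge (hF n) ha hb) ?_
    refine tendsto_of_tendsto_of_tendsto_of_le_of_le tendsto_const_nhds ?_ (fun _ => zero_le)
      fun n => eLpNorm_one_edge_le (F n - F') ((hF n).1.sub hF'.1) ha hb
    have := ENNReal.Tendsto.mul_const (b := volume (Ioo a b) ^ (1 / 2 : ℝ)) hlim
      (Or.inr (ENNReal.rpow_ne_top_of_nonneg (by norm_num) (by simp)))
    rwa [zero_mul] at this
  rcases le_total a b with h | h
  · exact key ha hb h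
  · simp only [intervalIntegral.integral_symm b a]
    exact (key hb ha h).neg

/-- Cauchy sequences in `L²` converge. -/
theorem exists_memLp_tendsto_eLpNorm {α : Type*} [MeasurableSpace α] {μ : Measure α}
    {F : ℕ → α → 𝕜} (hF : ∀ n, MemLp (F n) 2 μ)
    (hc : ∀ ε : ℝ≥0∞, 0 < ε → ∃ N, ∀ n ≥ N, ∀ m ≥ N, eLpNorm (F n - F m) 2 μ < ε) :
    ∃ F', MemLp F' 2 μ ∧ Tendsto (fun n => eLpNorm (F n - F') 2 μ) atTop (𝓝 0) := by
  have hcs : CauchySeq fun n => (hF n).toLp (F n) := by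
    refine EMetric.cauchySeq_iff.2 fun ε hε => ?_
    obtain ⟨N, hN⟩ := hc ε hε
    refine ⟨N, fun m hm n hn => ?_⟩
    rw [Lp.edist_toLp_toLp]
    exact hN m hm n hn
  obtain ⟨L, hL⟩ := cauchySeq_tendsto_of_complete hcs
  refine ⟨L, Lp.memLp L, ?_⟩
  rw [← Lp.tendsto_Lp_iff_tendsto_eLpNorm'' F hF L (Lp.memLp L), Lp.toLp_coeFn]
  exact hL

/-- Sobolev turns the Cauchy condition into uniform convergence, so the limit is continuous across
vertices and keeps the zeros at outer vertices. The slopes converge in L², and their limit is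
identified as the slope of the limit by passing to the limit in the fundamental theorem of calculus.
-/
theorem exists_memH10_tendsto_h1NormSq [Countable G.Edge] (hconn : IsConnected G.carrier)
    (hunb : G.IsUnbounded) {u : ℕ → EuclideanSpace ℝ (Fin d) → 𝕜} (hu : ∀ n, G.MemH10 (u n))
    (hc : ∀ ε : ℝ≥0∞, 0 < ε → ∃ N, ∀ n ≥ N, ∀ m ≥ N, G.h1NormSq (u n - u m) < ε) :
    ∃ w, G.MemH10 w ∧ Tendsto (fun n => G.h1NormSq (u n - w)) atTop (𝓝 0) := by
  have hcsq : ∀ ε : ℝ≥0∞, 0 < ε → ∃ N, ∀ n ≥ N, ∀ m ≥ N,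
      eLpNorm (G.slope (u n - u m)) 2 G.edgeMeasure < ε ∧
      eLpNorm (fun x => (u n - u m) (G.pt x)) 2 G.edgeMeasure < ε := by
    intro ε hε
    obtain ⟨N, hN⟩ := hc (ε ^ 2) (by positivity)
    refine ⟨N, fun n hn m hm => ?_⟩
    have h := hN n hn m hm
    rw [h1NormSq_eq_eLpNorm] at h
    exact ⟨lt_of_pow_lt_pow_left' 2 (lt_of_le_of_lt le_self_add h),
      lt_of_pow_lt_pow_left' 2 (lt_of_le_of_lt le_add_self h)⟩
  -- the uniform limit
  have hunif : UniformCauchySeqOn u atTop G.carrier := by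
    rw [Metric.uniformCauchySeqOn_iff]
    intro ε hε
    obtain ⟨N, hN⟩ := hc (ENNReal.ofReal (ε ^ 2 / 2)) (by simp; positivity)
    refine ⟨N, fun m hm n hn x hx => ?_⟩
    have h1 := ((hu m).1.sub (hu n).1).norm_sq_le hconn hunb hx
    have h2 := ENNReal.toReal_lt_of_lt_ofReal (hN m hm n hn)
    rw [dist_eq_norm]
    refine lt_of_pow_lt_pow_left₀ 2 hε.le ?_
    rw [Pi.sub_apply] at h1
    linarith
  have hex : ∀ x, ∃ l, x ∈ G.carrier → Tendsto (fun n => u n x) atTop (𝓝 l) := fun x => by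
    by_cases hx : x ∈ G.carrier
    · obtain ⟨l, hl⟩ := cauchySeq_tendsto_of_complete (hunif.cauchySeq hx)
      exact ⟨l, fun _ => hl⟩
    · exact ⟨0, fun h => absurd h hx⟩
  choose w hw using hex
  have hwc : ContinuousOn w G.carrier :=
    (hunif.tendstoUniformlyOn_of_tendsto hw).continuousOn
      (Frequently.of_forall fun n => (hu n).1.continuousOn)
  -- the limit of the derivatives
  obtain ⟨D, hD, hDlim⟩ := exists_memLp_tendsto_eLpNorm (fun n => (hu n).1.memLp_slope)
    fun ε hε => by
      obtain ⟨N, hN⟩ := hcsq ε hε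
      refine ⟨N, fun n hn m hm => ?_⟩
      rw [← (hu n).1.eLpNorm_slope_sub (hu m).1]
      exact (hN n hn m hm).1
  have hwD : ∀ e, ∀ a ∈ G.closedParam e, ∀ b ∈ G.closedParam e,
      w (G.point e b) - w (G.point e a) = ∫ t in a..b, D (e, t) := fun e a ha b hb => by
    refine tendsto_nhds_unique ((hw _ (point_mem_carrier hb)).sub (hw _ (point_mem_carrier ha))) ?_
    simp only [fun n => (hu n).1.sub_eq_integral_slope ha hb]
    exact tendsto_integral_edge (fun n => (hu n).1.memLp_slope) hD hDlim ha hb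
  have hslope : G.slope w =ᵐ[G.edgeMeasure] D :=
    ae_edgeMeasure_iff.2 fun e => ae_restrict_openParam fun b hb => by
      have h0 := zero_mem_closedParam e
      filter_upwards [ae_hasDerivAt_of_sub_eq_integral (intervalIntegrable_edge hD h0 hb)
        fun t ht => hwD e 0 h0 t ((ordConnected_closedParam e).uIcc_subset h0 hb ht)] with t ht ht'
      exact (ht ht').deriv
  -- convergence of the functions
  have hL2 : Tendsto (fun n => eLpNorm (fun x => (u n - w) (G.pt x)) 2 G.edgeMeasure)
      atTop (𝓝 0) := by
    rw [ENNReal.tendsto_atTop_zero]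
    intro ε hε
    obtain ⟨N, hN⟩ := hcsq ε hε
    refine ⟨N, fun n hn => ?_⟩
    -- With n fixed, Fatou as m → ∞ carries the Cauchy bound over to `u n - w`.
    have hae : ∀ᵐ x ∂G.edgeMeasure, Tendsto (fun m => (u n - u m) (G.pt x)) atTop
        (𝓝 ((u n - w) (G.pt x))) := by
      filter_upwards [ae_mem_openParam] with x hx
      exact tendsto_const_nhds.sub (hw _ (pt_mem_carrier hx))
    refine (Lp.eLpNorm_lim_le_liminf_eLpNorm (f := fun m x => (u n - u m) (G.pt x))
      (fun m => aestronglyMeasurable_comp_pt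
      ((hu n).1.continuousOn.sub (hu m).1.continuousOn)) _ hae).trans ?_
    refine liminf_le_of_frequently_le' (Eventually.frequently ?_)
    filter_upwards [eventually_ge_atTop N] with m hm using (hN n hn m hm).2.le
  have hfin : G.h1NormSq w < ⊤ := by
    obtain ⟨n, hn⟩ := (hL2.eventually_lt_const ENNReal.zero_lt_top).exists
    have hwm : MemLp (fun x => w (G.pt x)) 2 G.edgeMeasure := by
      have h1 : MemLp (fun x => (u n - w) (G.pt x)) 2 G.edgeMeasure :=
        ⟨aestronglyMeasurable_comp_pt ((hu n).1.continuousOn.sub hwc), hn⟩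
      have h2 := (hu n).1.memLp_comp_pt.sub h1
      convert h2 using 1
      ext x
      simp
    rw [h1NormSq_eq_eLpNorm, eLpNorm_congr_ae hslope]
    exact ENNReal.add_lt_top.2 ⟨ENNReal.pow_lt_top hD.2, ENNReal.pow_lt_top hwm.2⟩
  have hwH : G.MemH1 w :=
    { continuousOn := hwc
      absolutelyContinuous := fun e a ha b hb => by
        have hsub := (ordConnected_closedParam e).uIcc_subset ha hb
        exact absolutelyContinuousOnInterval_of_sub_eq_integral
          (intervalIntegrable_edge hD ha hb)
          fun s hs t ht => hwD e s (hsub hs) t (hsub ht)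
      h1NormSq_lt_top := hfin }
  refine ⟨w, ⟨hwH, fun V hV => ?_⟩, ?_⟩
  · obtain ⟨e, he, _⟩ := hV.2
    have h := hw V (mem_iUnion.2 ⟨e, he⟩)
    simp only [fun n => (hu n).2 V hV] at h
    exact tendsto_nhds_unique h tendsto_const_nhds
  · have h1 : Tendsto (fun n => eLpNorm (G.slope (u n - w)) 2 G.edgeMeasure) atTop (𝓝 0) := by
      refine hDlim.congr fun n => ?_
      rw [(hu n).1.eLpNorm_slope_sub hwH]
      exact eLpNorm_congr_ae (hslope.symm.mono fun x hx => by simp [hx])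
    simp only [h1NormSq_eq_eLpNorm]
    simpa using (ENNReal.Tendsto.pow (n := 2) h1).add (ENNReal.Tendsto.pow (n := 2) hL2)

end EmbeddedGraph

namespace EmbeddedGraph

variable {d : ℕ} {G : EmbeddedGraph d} {𝕜 : Type*} [RCLike 𝕜]
  {f g : EuclideanSpace ℝ (Fin d) → 𝕜}

/-! ### Compactness of tight minimising sequences -/

/-- A compact ball meets finitely many edges by local finiteness, and each edge meets it in a
parameter set of bounded diameter. -/
theorem edgeMeasure_ball_lt_top [Countable G.Edge] (hfin : G.IsLocallyFinite)
    (x : EuclideanSpace ℝ (Fin d)) (R : ℝ) :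
    G.edgeMeasure (G.pt ⁻¹' Metric.ball x R) < ⊤ := by
  rw [← setLIntegral_one, setLIntegral_edgeMeasure _ measurableSet_ball]
  simp only [setLIntegral_one]
  have hF := hfin.finite_nonempty_inter_compact (isCompact_closedBall x R)
  rw [tsum_eq_sum (s := hF.toFinset) fun e he => ?_]
  · refine ENNReal.sum_lt_top.2 fun e _ => ?_
    refine Bornology.IsBounded.measure_lt_top (Bornology.IsBounded.subset ?_ inter_subset_right)
    rw [Metric.isBounded_iff]
    obtain ⟨C, hC⟩ := Metric.isBounded_iff.1 (Metric.isBounded_ball (x := x) (r := R))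
    refine ⟨C, fun s hs t ht => ?_⟩
    rw [← dist_point e]
    exact hC hs ht
  · have : G.openParam e ∩ G.point e ⁻¹' Metric.ball x R = ∅ := by
      by_contra hne
      obtain ⟨t, ht1, ht2⟩ := nonempty_iff_ne_empty.2 hne
      exact he (hF.mem_toFinset.2 ⟨G.point e t,
        mem_image_of_mem _ (openParam_subset_closedParam e ht1), Metric.ball_subset_closedBall ht2⟩)
    rw [this, measure_empty]

/-- The modulus of continuity along an edge is controlled by the energy. -/
theorem MemH1.norm_sub_le [Countable G.Edge] (hf : G.MemH1 f) {e : G.Edge} {s t : ℝ}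
    (hs : s ∈ G.closedParam e) (ht : t ∈ G.closedParam e) (hst : s ≤ t) {K : ℝ} (hK : 0 < K) :
    ‖f (G.point e t) - f (G.point e s)‖ ≤ K * (t - s) + (G.h1NormSq f).toReal / K := by
  have hE := hf.h1NormSq_lt_top
  -- This is |f'| ≤ K + |f'|²/K; the free parameter K stands in for the Cauchy–Schwarz inequality.
  have hpt : ∀ r, ‖G.slope f (e, r)‖ₑ ≤
      ENNReal.ofReal K + ENNReal.ofReal K⁻¹ * ENNReal.ofReal (G.dens f (e, r)) := fun r => by
    rw [← ofReal_norm, ← ENNReal.ofReal_mul (by positivity),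
      ← ENNReal.ofReal_add hK.le (mul_nonneg (by positivity) (G.dens_nonneg _ _))]
    refine ENNReal.ofReal_le_ofReal ?_
    have h1 : ‖G.slope f (e, r)‖ ^ 2 ≤ G.dens f (e, r) := le_add_of_nonneg_right (by positivity)
    have h2 : K⁻¹ * ‖G.slope f (e, r)‖ ^ 2 ≤ K⁻¹ * G.dens f (e, r) := by gcongr
    have h3 : 0 ≤ K⁻¹ * (‖G.slope f (e, r)‖ - K) ^ 2 := by positivity
    have h4 : K⁻¹ * (‖G.slope f (e, r)‖ - K) ^ 2 =
        K⁻¹ * ‖G.slope f (e, r)‖ ^ 2 - 2 * ‖G.slope f (e, r)‖ + K := by field_simp; ring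
    linarith [norm_nonneg (G.slope f (e, r))]
  have hedge : ∫⁻ r in G.openParam e, ENNReal.ofReal (G.dens f (e, r)) ≤ G.h1NormSq f := by
    rw [h1NormSq, energyOn_eq f MeasurableSet.univ,
      setLIntegral_edgeMeasure _ MeasurableSet.univ]
    simp only [preimage_univ, inter_univ]
    exact ENNReal.le_tsum e
  have hle : ‖f (G.point e t) - f (G.point e s)‖ₑ ≤
      ENNReal.ofReal (K * (t - s) + (G.h1NormSq f).toReal / K) := by
    calc ‖f (G.point e t) - f (G.point e s)‖ₑ ≤ ∫⁻ r in Ioo s t, ‖G.slope f (e, r)‖ₑ := by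
          rw [hf.sub_eq_integral_slope hs ht, intervalIntegral.integral_of_le hst,
            integral_Ioc_eq_integral_Ioo]
          exact enorm_integral_le_lintegral_enorm _
      _ ≤ ∫⁻ r in Ioo s t, (ENNReal.ofReal K +
            ENNReal.ofReal K⁻¹ * ENNReal.ofReal (G.dens f (e, r))) := lintegral_mono hpt
      _ = ENNReal.ofReal K * ENNReal.ofReal (t - s) +
            ENNReal.ofReal K⁻¹ * ∫⁻ r in Ioo s t, ENNReal.ofReal (G.dens f (e, r)) := by
          rw [lintegral_add_left measurable_const, setLIntegral_const, Real.volume_Ioo,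
            lintegral_const_mul' _ _ ENNReal.ofReal_ne_top]
      _ ≤ ENNReal.ofReal K * ENNReal.ofReal (t - s) +
            ENNReal.ofReal K⁻¹ * ENNReal.ofReal (G.h1NormSq f).toReal := by
          gcongr
          rw [ENNReal.ofReal_toReal hE.ne]
          exact (lintegral_mono_set (Ioo_subset_openParam hs ht)).trans hedge
      _ = _ := by
          have h0 : (0 : ℝ) ≤ (G.h1NormSq f).toReal := ENNReal.toReal_nonneg
          rw [← ENNReal.ofReal_mul hK.le, ← ENNReal.ofReal_mul (by positivity),
            ← ENNReal.ofReal_add (mul_nonneg hK.le (by linarith)) (by positivity), div_eq_inv_mul]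
  rw [← ofReal_norm] at hle
  refine (ENNReal.ofReal_le_ofReal_iff ?_).1 hle
  have h0 : (0 : ℝ) ≤ (G.h1NormSq f).toReal := ENNReal.toReal_nonneg
  have : 0 ≤ t - s := by linarith
  positivity

/-- A bounded sequence in `H¹(G)` has a subsequence that converges at every point of the edges. -/
theorem exists_subseq_tendsto_pointwise [Countable G.Edge] (hconn : IsConnected G.carrier)
    (hunb : G.IsUnbounded) {u : ℕ → EuclideanSpace ℝ (Fin d) → 𝕜} (hu : ∀ n, G.MemH1 (u n))
    {M : ℝ} (hM : 0 < M) (hE : ∀ n, (G.h1NormSq (u n)).toReal ≤ M) :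
    ∃ φ : ℕ → ℕ, StrictMono φ ∧ ∃ U : G.Edge × ℝ → 𝕜, ∀ x : G.Edge × ℝ, x.2 ∈ G.openParam x.1 →
      Tendsto (fun n => u (φ n) (G.pt x)) atTop (𝓝 (U x)) := by
  classical
  -- Values at the countably many rational parameters, with 0 where the parameter leaves the edge,
  -- form points of one compact metrisable product; equicontinuity along edges then extends
  -- convergence to all parameters.
  set y : ℕ → G.Edge × ℚ → 𝕜 := fun n z =>
    if (z.2 : ℝ) ∈ G.closedParam z.1 then u n (G.point z.1 z.2) else 0 with hy
  have hcomp : IsCompact (univ.pi fun _ : G.Edge × ℚ => Metric.closedBall (0 : 𝕜) √(2 * M)) :=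
    isCompact_univ_pi fun _ => isCompact_closedBall _ _
  have hmem : ∀ n, y n ∈ univ.pi fun _ : G.Edge × ℚ => Metric.closedBall (0 : 𝕜) √(2 * M) := by
    intro n z _
    rw [mem_closedBall_zero_iff]
    simp only [hy]
    split_ifs with hz
    · refine Real.le_sqrt_of_sq_le (((hu n).norm_sq_le hconn hunb (point_mem_carrier hz)).trans ?_)
      linarith [hE n]
    · simp
  obtain ⟨Y, _, φ, hφ, hlim⟩ := hcomp.tendsto_subseq hmem
  refine ⟨φ, hφ, ?_⟩
  have hcau : ∀ x : G.Edge × ℝ, ∃ l, x.2 ∈ G.openParam x.1 →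
      Tendsto (fun n => u (φ n) (G.pt x)) atTop (𝓝 l) := by
    rintro ⟨e, t⟩
    by_cases ht : t ∈ G.openParam e
    swap
    · exact ⟨0, fun h => absurd h ht⟩
    suffices CauchySeq fun n => u (φ n) (G.point e t) by
      obtain ⟨l, hl⟩ := cauchySeq_tendsto_of_complete this
      exact ⟨l, fun _ => hl⟩
    rw [Metric.cauchySeq_iff]
    intro ε hε
    -- This makes the energy term M/K equal to ε/8; the rational q is then taken so close to t that
    -- K(q - t) ≤ ε/8 as well.
    set K : ℝ := 8 * M / ε with hK
    have hK0 : 0 < K := by positivity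
    obtain ⟨r, hr, hball⟩ := Metric.isOpen_iff.1 (isOpen_openParam e) t ht
    obtain ⟨q, hq1, hq2⟩ := exists_rat_btwn (show t < t + min r (ε / (8 * K)) by
      have : 0 < min r (ε / (8 * K)) := by positivity
      linarith)
    have hqr : (q : ℝ) - t < r := by linarith [min_le_left r (ε / (8 * K))]
    have hqK : K * (q - t) ≤ ε / 8 := by
      have h1 : (q : ℝ) - t ≤ ε / (8 * K) := by linarith [min_le_right r (ε / (8 * K))]
      calc K * (q - t) ≤ K * (ε / (8 * K)) := by gcongr
        _ = ε / 8 := by field_simp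
    have hq : (q : ℝ) ∈ G.closedParam e := openParam_subset_closedParam e (hball (by
      rw [Metric.mem_ball, Real.dist_eq, abs_of_pos] <;> linarith))
    have hclose : ∀ n, dist (u (φ n) (G.point e q)) (u (φ n) (G.point e t)) ≤ ε / 4 := fun n => by
      rw [dist_eq_norm]
      refine ((hu (φ n)).norm_sub_le (openParam_subset_closedParam e ht) hq hq1.le hK0).trans ?_
      have : (G.h1NormSq (u (φ n))).toReal / K ≤ ε / 8 := by
        calc (G.h1NormSq (u (φ n))).toReal / K ≤ M / K := by gcongr; exact hE _
          _ = ε / 8 := by rw [hK]; field_simp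
      linarith
    have hq' : CauchySeq fun n => u (φ n) (G.point e q) := by
      have h := ((continuous_apply (e, q)).tendsto Y).comp hlim
      refine Tendsto.cauchySeq (x := Y (e, q)) (h.congr fun n => ?_)
      simp [hy, hq]
    obtain ⟨N, hN⟩ := Metric.cauchySeq_iff.1 hq' (ε / 4) (by positivity)
    refine ⟨N, fun m hm n hn => ?_⟩
    have h1 := hN m hm n hn
    have h2 := hclose m
    have h3 := hclose n
    rw [dist_comm] at h2
    have := dist_triangle4 (u (φ m) (G.point e t)) (u (φ m) (G.point e q))
      (u (φ n) (G.point e q)) (u (φ n) (G.point e t))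
    linarith
  choose U hU using hcau
  exact ⟨U, hU⟩

/-- Bounded pointwise convergence implies convergence of the mass in balls. -/
theorem tendsto_massOn_ball [Countable G.Edge] (hfin : G.IsLocallyFinite) {ι : Type*}
    {l : Filter ι} [l.IsCountablyGenerated] {p : ℝ} (hp : 0 ≤ p)
    {u : ι → EuclideanSpace ℝ (Fin d) → 𝕜} {U : G.Edge × ℝ → 𝕜} {C : ℝ}
    (hc : ∀ i, ContinuousOn (u i) G.carrier) (hC : ∀ i, ∀ x ∈ G.carrier, ‖u i x‖ ≤ C)
    (hU : ∀ x : G.Edge × ℝ, x.2 ∈ G.openParam x.1 → Tendsto (fun i => u i (G.pt x)) l (𝓝 (U x)))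
    (x : EuclideanSpace ℝ (Fin d)) (R : ℝ) :
    Tendsto (fun i => G.massOn p (u i) (Metric.ball x R)) l
      (𝓝 (∫⁻ z in G.pt ⁻¹' Metric.ball x R, ENNReal.ofReal (‖U z‖ ^ p) ∂G.edgeMeasure)) := by
  simp only [massOn_eq hp _ measurableSet_ball]
  refine tendsto_lintegral_filter_of_dominated_convergence'
    (fun _ => ENNReal.ofReal (C ^ p))
    (Eventually.of_forall fun i => (aemeasurable_norm_rpow (hc i) p).restrict) ?_ ?_ ?_
  · refine Eventually.of_forall fun i => ae_restrict_of_ae ?_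
    filter_upwards [ae_mem_openParam] with z hz
    gcongr
    exact hC i _ (pt_mem_carrier hz)
  · rw [setLIntegral_const]
    exact ENNReal.mul_ne_top ENNReal.ofReal_ne_top (edgeMeasure_ball_lt_top hfin x R).ne
  · refine ae_restrict_of_ae ?_
    filter_upwards [ae_mem_openParam] with z hz
    exact ENNReal.tendsto_ofReal
      (((Real.continuous_rpow_const hp).tendsto _).comp (hU z hz).norm)

theorem massOn_ball_add_compl [Countable G.Edge] {p : ℝ} (hp : 0 ≤ p)
    (f : EuclideanSpace ℝ (Fin d) → 𝕜) (x : EuclideanSpace ℝ (Fin d)) (R : ℝ) :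
    G.massOn p f (Metric.ball x R) + G.massOn p f (Metric.ball x R)ᶜ = G.massOn p f univ := by
  rw [massOn_eq hp f measurableSet_ball, massOn_eq hp f measurableSet_ball.compl,
    massOn_univ_eq hp]
  exact lintegral_add_compl _ (measurable_pt measurableSet_ball)

theorem ofReal_one_sub_le_massOn_ball [Countable G.Edge] {p : ℝ} (hp : 0 ≤ p)
    {x : EuclideanSpace ℝ (Fin d)} {R ε : ℝ} (hε : 0 ≤ ε) (h1 : G.massOn p f univ = 1)
    (h2 : G.massOn p f (Metric.ball x R)ᶜ ≤ ENNReal.ofReal ε) :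
    ENNReal.ofReal (1 - ε) ≤ G.massOn p f (Metric.ball x R) := by
  have := massOn_ball_add_compl (G := G) hp f x R
  rw [ENNReal.ofReal_sub _ hε, ENNReal.ofReal_one, tsub_le_iff_right, ← h1, ← this]
  gcongr

/-- For a tight sequence of normalised functions that converges pointwise, the mass of
`u n + u m` is asymptotically at least `2 ^ p`. -/
theorem eventually_lt_massOn_add [Countable G.Edge] (hfin : G.IsLocallyFinite) {p : ℝ}
    (hp : 0 < p) {u : ℕ → EuclideanSpace ℝ (Fin d) → 𝕜} {U : G.Edge × ℝ → 𝕜} {C : ℝ}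
    (hc : ∀ n, ContinuousOn (u n) G.carrier) (hC : ∀ n, ∀ x ∈ G.carrier, ‖u n x‖ ≤ C)
    (hU : ∀ x : G.Edge × ℝ, x.2 ∈ G.openParam x.1 →
      Tendsto (fun n => u n (G.pt x)) atTop (𝓝 (U x)))
    (hm : ∀ n, G.massOn p (u n) univ = 1)
    (htight : ∀ ε : ℝ, 0 < ε → ∃ R : ℝ, ∀ᶠ n in atTop,
      G.massOn p (u n) (Metric.ball 0 R)ᶜ ≤ ENNReal.ofReal ε) {q : ℝ} (hq0 : 0 ≤ q)
    (hq : q < 2 ^ p) :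
    ∀ᶠ z : ℕ × ℕ in atTop, ENNReal.ofReal q < G.massOn p (u z.1 + u z.2) univ := by
  -- The witness makes 2^p (1 - ε) the midpoint of q and 2^p.
  obtain ⟨ε, hε, hqε⟩ : ∃ ε : ℝ, 0 < ε ∧ q < 2 ^ p * (1 - ε) := by
    have h2 : (0 : ℝ) < 2 ^ p := by positivity
    refine ⟨(2 ^ p - q) / (2 * 2 ^ p), div_pos (by linarith) (by positivity), ?_⟩
    have : (2 : ℝ) ^ p * (1 - (2 ^ p - q) / (2 * 2 ^ p)) = (2 ^ p + q) / 2 := by field_simp; ring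
    linarith
  obtain ⟨R, hR⟩ := htight ε hε
  set J := ∫⁻ z in G.pt ⁻¹' Metric.ball (0 : EuclideanSpace ℝ (Fin d)) R,
    ENNReal.ofReal (‖U z‖ ^ p) ∂G.edgeMeasure with hJ
  have hJε : ENNReal.ofReal (1 - ε) ≤ J := by
    refine ge_of_tendsto (tendsto_massOn_ball hfin hp.le hc hC hU 0 R) ?_
    filter_upwards [hR] with n hn using ofReal_one_sub_le_massOn_ball hp.le hε.le (hm n) hn
  -- Both indices tend to infinity independently, and the pointwise limit of the sum is 2U.
  have hlim := tendsto_massOn_ball hfin hp.le (l := (atTop : Filter (ℕ × ℕ)))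
    (u := fun z => u z.1 + u z.2) (U := fun x => U x + U x) (C := C + C)
    (fun z => (hc z.1).add (hc z.2))
    (fun z x hx => (norm_add_le _ _).trans (add_le_add (hC z.1 x hx) (hC z.2 x hx)))
    (fun x hx => by
      rw [← prod_atTop_atTop_eq]
      exact ((hU x hx).comp tendsto_fst).add ((hU x hx).comp tendsto_snd)) 0 R
  have hval : ∫⁻ z in G.pt ⁻¹' Metric.ball (0 : EuclideanSpace ℝ (Fin d)) R,
      ENNReal.ofReal (‖U z + U z‖ ^ p) ∂G.edgeMeasure = ENNReal.ofReal (2 ^ p) * J := by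
    rw [hJ, ← lintegral_const_mul' _ _ ENNReal.ofReal_ne_top]
    refine lintegral_congr fun z => ?_
    rw [← ENNReal.ofReal_mul (by positivity), ← two_mul, norm_mul,
      Real.mul_rpow (norm_nonneg _) (norm_nonneg _), RCLike.norm_ofNat]
  rw [hval] at hlim
  have hlt : ENNReal.ofReal q < ENNReal.ofReal (2 ^ p) * J := by
    refine lt_of_lt_of_le ?_ (mul_le_mul_right hJε _)
    rw [← ENNReal.ofReal_mul (by positivity)]
    exact (ENNReal.ofReal_lt_ofReal_iff (lt_of_le_of_lt hq0 hqε)).2 hqε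
  filter_upwards [hlim.eventually_const_lt hlt] with z hz
  exact hz.trans_le (massOn_mono _ (subset_univ _))

/-- A tight minimising sequence has a convergent subsequence. -/
theorem exists_subseq_tendsto_of_tight [Countable G.Edge] (hconn : IsConnected G.carrier)
    (hfin : G.IsLocallyFinite) (hunb : G.IsUnbounded) {p : ℝ} (hp : 2 < p)
    (hI : G.infQuotient 𝕜 p ≠ ⊤) {u : ℕ → EuclideanSpace ℝ (Fin d) → 𝕜}
    (hu : ∀ n, G.MemH10 (u n)) (hm : ∀ n, G.massOn p (u n) univ = 1)
    (hlim : Tendsto (fun n => (G.h1NormSq (u n)).toReal) atTop (𝓝 (G.infQuotient 𝕜 p).toReal))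
    (htight : ∀ ε : ℝ, 0 < ε → ∃ R : ℝ, ∀ᶠ n in atTop,
      G.massOn p (u n) (Metric.ball 0 R)ᶜ ≤ ENNReal.ofReal ε) :
    ∃ φ : ℕ → ℕ, StrictMono φ ∧ ∃ w, G.MemH10 w ∧
      Tendsto (fun n => G.h1NormSq (u (φ n) - w)) atTop (𝓝 0) := by
  have hI0 : 0 < (G.infQuotient 𝕜 p).toReal := ENNReal.toReal_pos
    (lt_of_lt_of_le (by simp) (half_le_infQuotient (𝕜 := 𝕜) hconn hunb hp)).ne' hI
  set I : ℝ := (G.infQuotient 𝕜 p).toReal with hIdef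
  obtain ⟨M, hM⟩ := hlim.bddAbove_range
  have hM' : ∀ n, (G.h1NormSq (u n)).toReal ≤ max M 1 := fun n =>
    (hM (mem_range_self n)).trans (le_max_left _ _)
  obtain ⟨φ, hφ, U, hU⟩ := exists_subseq_tendsto_pointwise hconn hunb (fun n => (hu n).1)
    (lt_max_of_lt_right one_pos) hM'
  have hφt := hφ.tendsto_atTop
  refine ⟨φ, hφ, exists_memH10_tendsto_h1NormSq hconn hunb (fun n => hu (φ n)) fun ε hε => ?_⟩
  obtain ⟨η₀, h0, hη₀⟩ := ENNReal.lt_iff_exists_nnreal_btwn.1 hε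
  have hη₀0 : (0 : ℝ) < η₀ := by exact_mod_cast h0
  -- The cap at I keeps b nonnegative. The budget is 4(I + η/8) - (4I - η/2) = η: the parallelogram
  -- law with both energies below I + η/8 and the energy of the sum above bI = 4I - η/2.
  set η : ℝ := min η₀ I with hη
  have hη0 : 0 < η := lt_min hη₀0 hI0
  have hηI : η ≤ I := min_le_right _ _
  set b : ℝ := (4 * I - η / 2) / I with hb
  have hb0 : 0 ≤ b := div_nonneg (by linarith) hI0.le
  have hb4 : b < 4 := by rw [hb, div_lt_iff₀ hI0]; linarith
  have hq : b ^ (p / 2) < 2 ^ p := by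
    calc b ^ (p / 2) < 4 ^ (p / 2) := Real.rpow_lt_rpow hb0 hb4 (by linarith)
      _ = 2 ^ p := by
        rw [show (4 : ℝ) = 2 ^ (2 : ℝ) by norm_num, ← Real.rpow_mul (by norm_num)]
        congr 1; ring
  have hmass := eventually_lt_massOn_add hfin (by linarith) (fun n => (hu (φ n)).1.continuousOn)
    (C := √(2 * max M 1)) (fun n x hx => Real.le_sqrt_of_sq_le
      (((hu (φ n)).1.norm_sq_le hconn hunb hx).trans (by linarith [hM' (φ n)]))) hU
    (fun n => hm (φ n)) (fun δ hδ => by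
      obtain ⟨R, hR⟩ := htight δ hδ
      exact ⟨R, hφt.eventually hR⟩) (by positivity) hq
  obtain ⟨N₁, hN₁⟩ := eventually_atTop_prod_self.1 hmass
  obtain ⟨N₂, hN₂⟩ := eventually_atTop.1 ((hlim.comp hφt).eventually_lt_const
    (show I < I + η / 8 by linarith))
  refine ⟨max N₁ N₂, fun n hn m hm' => ?_⟩
  have hadd := (hu (φ n)).add (hu (φ m))
  have hsub := (hu (φ n)).1.sub (hu (φ m)).1
  have h1 : b ^ (p / 2) < ((G.h1NormSq (u (φ n) + u (φ m))).toReal / I) ^ (p / 2) := by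
    refine lt_of_lt_of_le ?_ (hadd.toReal_massOn_le hconn hunb hp hI)
    refine (ENNReal.ofReal_lt_iff_lt_toReal (by positivity)
      (hadd.1.massOn_ne_top hconn hunb hp)).1 ?_
    exact hN₁ n m ((le_max_left _ _).trans hn) ((le_max_left _ _).trans hm')
  rw [Real.rpow_lt_rpow_iff hb0 (by positivity) (by linarith), hb,
    div_lt_div_iff_of_pos_right hI0] at h1
  have h2 := hN₂ n ((le_max_right _ _).trans hn)
  have h3 := hN₂ m ((le_max_right _ _).trans hm')
  simp only [Function.comp_apply] at h2 h3
  have h4 := congrArg ENNReal.toReal ((hu (φ n)).1.h1NormSq_parallelogram (hu (φ m)).1)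
  rw [ENNReal.toReal_add hadd.1.h1NormSq_lt_top.ne hsub.h1NormSq_lt_top.ne,
    ENNReal.toReal_add (ENNReal.mul_ne_top (by simp) (hu _).1.h1NormSq_lt_top.ne)
      (ENNReal.mul_ne_top (by simp) (hu _).1.h1NormSq_lt_top.ne),
    ENNReal.toReal_mul, ENNReal.toReal_mul, ENNReal.toReal_ofNat] at h4
  refine lt_of_le_of_lt ?_ hη₀
  rw [← ENNReal.ofReal_coe_nnreal]
  refine (ENNReal.le_ofReal_iff_toReal_le hsub.h1NormSq_lt_top.ne hη₀0.le).2 ?_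
  have : η ≤ η₀ := min_le_left _ _
  linarith

end EmbeddedGraph

namespace EmbeddedGraph

variable {d : ℕ} {G : EmbeddedGraph d} {𝕜 : Type*} [RCLike 𝕜]
  {f : EuclideanSpace ℝ (Fin d) → 𝕜}

/-! ### Concentration -/

/-- The integral of an integrable function outside large balls is small. -/
theorem exists_forall_setLIntegral_compl_ball_le [Countable G.Edge] {H : G.Edge × ℝ → ℝ≥0∞}
    (hH : ∫⁻ z, H z ∂G.edgeMeasure ≠ ⊤) (x : EuclideanSpace ℝ (Fin d)) {ε : ℝ≥0∞} (hε : 0 < ε) :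
    ∃ R : ℝ, ∀ r ≥ R, ∫⁻ z in G.pt ⁻¹' (Metric.ball x r)ᶜ, H z ∂G.edgeMeasure ≤ ε := by
  have hs : ∀ r : ℝ, MeasurableSet (G.pt ⁻¹' (Metric.ball x r)ᶜ) := fun r =>
    measurable_pt measurableSet_ball.compl
  have hanti : Antitone fun r : ℝ => G.pt ⁻¹' (Metric.ball x r)ᶜ := fun r s hrs =>
    preimage_mono (compl_subset_compl.2 (Metric.ball_subset_ball hrs))
  have hempty : ⋂ r : ℝ, G.pt ⁻¹' (Metric.ball x r)ᶜ = ∅ := by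
    refine eq_empty_of_forall_notMem fun z hz => ?_
    have := mem_iInter.1 hz (dist (G.pt z) x + 1)
    simp only [mem_preimage, mem_compl_iff, Metric.mem_ball, not_lt] at this
    linarith
  -- Continuity from above of the finite measure with density `H` along complements of balls, whose
  -- intersection is empty.
  have hlim := tendsto_measure_iInter_atTop (μ := G.edgeMeasure.withDensity H)
    (fun r => (hs r).nullMeasurableSet) hanti ⟨0, by
      rw [withDensity_apply _ (hs 0)]
      exact ((setLIntegral_le_lintegral _ _).trans_lt hH.lt_top).ne⟩
  rw [hempty, measure_empty] at hlim
  obtain ⟨R, hR⟩ := eventually_atTop.1 (hlim.eventually_lt_const hε)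
  refine ⟨R, fun r hr => ?_⟩
  rw [← withDensity_apply _ (hs r)]
  exact (hR r hr).le

/-- A normalised minimising sequence concentrates around suitable points of the graph. -/
theorem exists_concentration [Countable G.Edge]
    (hconn : IsConnected G.carrier) (hunb : G.IsUnbounded) {p : ℝ} (hp : 2 < p)
    (hI : G.infQuotient 𝕜 p ≠ ⊤) {v : ℕ → EuclideanSpace ℝ (Fin d) → 𝕜}
    (hv : ∀ n, G.MemH10 (v n)) (hm : ∀ n, G.massOn p (v n) univ = 1)
    (hlim : Tendsto (fun n => (G.h1NormSq (v n)).toReal) atTop (𝓝 (G.infQuotient 𝕜 p).toReal)) :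
    ∃ x : ℕ → EuclideanSpace ℝ (Fin d), (∀ n, x n ∈ G.carrier) ∧
      ∀ ε : ℝ, 0 < ε → ∃ R : ℝ, 0 < R ∧ ∀ n,
        G.energyOn (v n) (Metric.ball (x n) R)ᶜ ≤ ENNReal.ofReal ε ∧
        G.massOn p (v n) (Metric.ball (x n) R)ᶜ ≤ ENNReal.ofReal ε := by
  obtain ⟨x₀, hx₀⟩ := hconn.nonempty
  set I : ℝ := (G.infQuotient 𝕜 p).toReal with hIdef
  have hI0 : 0 ≤ I := ENNReal.toReal_nonneg
  obtain ⟨c, hc, hsel⟩ := exists_forall_ofReal_le_energyOn_ball (𝕜 := 𝕜) hconn hunb hp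
    (show 0 < I + 1 by linarith)
  -- Functions of energy above I + 1 get the dummy centre `x₀`; there are only finitely many of
  -- them.
  have hex : ∀ n, ∃ x ∈ G.carrier, (G.h1NormSq (v n)).toReal ≤ I + 1 →
      ENNReal.ofReal c ≤ G.energyOn (v n) (Metric.ball x 1) := fun n => by
    by_cases h : (G.h1NormSq (v n)).toReal ≤ I + 1
    · obtain ⟨x, hx, hxc⟩ := hsel (v n) (hv n).1 (hm n) h
      exact ⟨x, hx, fun _ => hxc⟩
    · exact ⟨x₀, hx₀, fun h' => absurd h' h⟩
  choose x hx hxc using hex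
  refine ⟨x, hx, fun ε hε => ?_⟩
  -- The mass outside the ball is controlled only by (2ε')^(p/2), so ε' is taken small for both
  -- tails.
  obtain ⟨ε', hε', hε'1, hε'2⟩ : ∃ ε' : ℝ, 0 < ε' ∧ ε' ≤ ε ∧ (2 * ε') ^ (p / 2) ≤ ε := by
    have hcont : Tendsto (fun t : ℝ => (2 * t) ^ (p / 2)) (𝓝[>] 0) (𝓝 0) := by
      have h : Continuous fun t : ℝ => (2 * t) ^ (p / 2) :=
        (Real.continuous_rpow_const (by linarith)).comp (continuous_const.mul continuous_id)
      have h0 := (h.tendsto 0).mono_left (nhdsWithin_le_nhds (s := Ioi 0))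
      rwa [mul_zero, Real.zero_rpow (by linarith)] at h0
    have hsmall : ∀ᶠ t : ℝ in 𝓝[>] 0, t ≤ ε :=
      mem_nhdsWithin_of_mem_nhds (Iic_mem_nhds hε)
    obtain ⟨t, ⟨h1, h2⟩, h3⟩ := ((hsmall.and (hcont.eventually_le_const hε)).and
      self_mem_nhdsWithin).exists
    exact ⟨t, h3, h1, h2⟩
  obtain ⟨R, δ, hR, hδ, H⟩ :=
    exists_forall_energyOn_compl_ball_le hconn hunb hp hI hc hε'
  obtain ⟨N, hN⟩ := eventually_atTop.1 (hlim.eventually_le_const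
    (show I < I + min δ 1 by linarith [lt_min hδ one_pos]))
  -- The finitely many functions that are not yet almost minimal are treated one by one, so that a
  -- single radius serves all n.
  have htail : ∀ n, ∃ r : ℝ, ∀ s ≥ r,
      G.energyOn (v n) (Metric.ball (x n) s)ᶜ ≤ ENNReal.ofReal ε ∧
      G.massOn p (v n) (Metric.ball (x n) s)ᶜ ≤ ENNReal.ofReal ε := fun n => by
    have hε2 : 0 < ENNReal.ofReal ε := ENNReal.ofReal_pos.2 hε
    obtain ⟨r₁, h₁⟩ := exists_forall_setLIntegral_compl_ball_le (G := G)
      (H := fun z => ENNReal.ofReal (G.dens (v n) z))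
      (by rw [← h1NormSq_eq]; exact (hv n).1.h1NormSq_lt_top.ne) (x n) hε2
    obtain ⟨r₂, h₂⟩ := exists_forall_setLIntegral_compl_ball_le (G := G)
      (H := fun z => ENNReal.ofReal (‖v n (G.pt z)‖ ^ p))
      (by rw [← massOn_univ_eq (by linarith), hm]; simp) (x n) hε2
    refine ⟨max r₁ r₂, fun s hs => ?_⟩
    rw [energyOn_eq _ measurableSet_ball.compl, massOn_eq (by linarith) _ measurableSet_ball.compl]
    exact ⟨h₁ s ((le_max_left _ _).trans hs), h₂ s ((le_max_right _ _).trans hs)⟩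
  choose r hr using htail
  obtain ⟨r', hr'⟩ := ((Finset.range N).image r).exists_le
  refine ⟨max R r', lt_max_of_lt_left hR, fun n => ?_⟩
  rcases lt_or_ge n N with hn | hn
  · exact hr n _ ((hr' _ (Finset.mem_image_of_mem r (Finset.mem_range.2 hn))).trans (le_max_right _ _))
  · have hEn := hN n hn
    obtain ⟨h1, h2⟩ := H (v n) (x n) (hv n) (hm n)
      (hEn.trans (by linarith [min_le_left δ 1]))
      (hxc n (hEn.trans (by linarith [min_le_right δ 1])))
    have hsub : (Metric.ball (x n) (max R r'))ᶜ ⊆ (Metric.ball (x n) R)ᶜ :=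
      compl_subset_compl.2 (Metric.ball_subset_ball (le_max_left _ _))
    exact ⟨(energyOn_mono _ hsub).trans (h1.trans (ENNReal.ofReal_le_ofReal hε'1)),
      (massOn_mono _ hsub).trans (h2.trans (ENNReal.ofReal_le_ofReal hε'2))⟩

theorem h1NormSq_sub_self (f : EuclideanSpace ℝ (Fin d) → 𝕜) : G.h1NormSq (f - f) = 0 := by
  simp [h1NormSq, energyOn]

end EmbeddedGraph

/-! ### The dichotomy: escaping or bounded centres -/

theorem mainTheorem4 {𝕜 : Type*} [RCLike 𝕜] {d : ℕ} (G : EmbeddedGraph d)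
    (hconn : IsConnected G.carrier) (hfin : G.IsLocallyFinite) (hunb : G.IsUnbounded)
    (hchain : ¬ G.IsChainEquivReal) (p : ℝ) (hp : 2 < p)
    (v : ℕ → EuclideanSpace ℝ (Fin d) → 𝕜) (hv : G.IsNormalizedMinimizingSeq p v) :
    G.IsRelativelyCompactSeq v ∨
      ∃ (φ : ℕ → ℕ) (w : ℕ → EuclideanSpace ℝ (Fin d) → 𝕜) (x : ℕ → EuclideanSpace ℝ (Fin d)),
        StrictMono φ ∧ (∀ n, G.MemH10 (w n)) ∧ (∀ n, x n ∈ G.carrier) ∧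
        Tendsto (fun n => ‖x n‖) atTop atTop ∧
        (∀ ε : ℝ, 0 < ε → ∃ R : ℝ, 0 < R ∧ ∀ n,
          ENNReal.ofReal (1 - ε) ≤ G.massOn p (w n) (Metric.ball (x n) R) ∧
          G.energyOn (w n) (Metric.ball (x n) R)ᶜ ≤ ENNReal.ofReal ε) ∧
        Tendsto (fun n => G.h1NormSq (v (φ n) - w n)) atTop (𝓝 0) := by
  have := hfin.countable_edge
  have hquot : ∀ n, G.quotient p (v n) = G.h1NormSq (v n) := fun n => by
    rw [EmbeddedGraph.quotient, hv.mass_eq_one n, ENNReal.one_rpow, div_one]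
  have hI : G.infQuotient 𝕜 p ≠ ⊤ := by
    have h := (hv.memH10 0).infQuotient_mul_le hp
    rw [hv.mass_eq_one 0, ENNReal.one_rpow, mul_one] at h
    exact (h.trans_lt (hv.memH10 0).1.h1NormSq_lt_top).ne
  have hlim : Tendsto (fun n => (G.h1NormSq (v n)).toReal) atTop
      (𝓝 (G.infQuotient 𝕜 p).toReal) := by
    have h := hv.tendsto_quotient
    simp only [hquot] at h
    exact (ENNReal.tendsto_toReal hI).comp h
  obtain ⟨x, hx, hconc⟩ := EmbeddedGraph.exists_concentration hconn hunb
    hp hI hv.memH10 hv.mass_eq_one hlim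
  -- The centres either leave every ball along a subsequence or eventually stay in one ball. In the
  -- latter case every subsequence of `v` is tight, as relative compactness demands.
  by_cases hfar : ∀ k : ℕ, ∃ᶠ n in atTop, (k : ℝ) ≤ ‖x n‖
  · obtain ⟨φ, hφ, hφx⟩ := extraction_forall_of_frequently hfar
    refine Or.inr ⟨φ, fun n => v (φ n), fun n => x (φ n), hφ, fun n => hv.memH10 _,
      fun n => hx _, tendsto_atTop_mono hφx tendsto_natCast_atTop_atTop, fun ε hε => ?_, ?_⟩
    · obtain ⟨R, hR, h⟩ := hconc ε hε
      exact ⟨R, hR, fun n => ⟨EmbeddedGraph.ofReal_one_sub_le_massOn_ball (by linarith) hε.le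
        (hv.mass_eq_one _) (h (φ n)).2, (h (φ n)).1⟩⟩
    · simp only [EmbeddedGraph.h1NormSq_sub_self]
      exact tendsto_const_nhds
  · push Not at hfar
    obtain ⟨k, hk⟩ := hfar
    refine Or.inl fun φ hφ => ?_
    have htight : ∀ ε : ℝ, 0 < ε → ∃ R : ℝ, ∀ᶠ n in atTop,
        G.massOn p (v (φ n)) (Metric.ball 0 R)ᶜ ≤ ENNReal.ofReal ε := fun ε hε => by
      obtain ⟨R, hR, h⟩ := hconc ε hε
      refine ⟨R + k, ?_⟩
      filter_upwards [hφ.tendsto_atTop.eventually hk] with n hn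
      refine (EmbeddedGraph.massOn_mono _ (compl_subset_compl.2 ?_)).trans (h (φ n)).2
      refine Metric.ball_subset_ball' ?_
      rw [dist_zero_right]
      linarith
    obtain ⟨ψ, hψ, w, hw, h⟩ := EmbeddedGraph.exists_subseq_tendsto_of_tight
      (u := fun n => v (φ n)) hconn hfin hunb hp hI (fun n => hv.memH10 (φ n))
      (fun n => hv.mass_eq_one (φ n)) (hlim.comp hφ.tendsto_atTop) htight
    exact ⟨ψ, hψ, w, hw, h⟩
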